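/- Consider quantum circuits $C$ on $\ell$ qubits, built from the gates Hadamard, Z, CZ and CCZ, of the form $C=H^{\otimes\ell}\,C'\,H^{\otimes\ell}$ with an arbitrary internal circuit $C'$ over these gates. Let $h$ be the number of Hadamard gates in $C'$ and $n=\ell+h$. The Hadamard gates in $C'$ divide its $\ell$ wires into $n$ segments; associate a variable over $\mathbb{F}_2$ with each segment. Let $f_C:\mathbb{F}_2^n\to\mathbb{F}_2$ be the sum over all gates of $C'$ of the following monomials: each Hadamard gate contributes the product of the variables of the two segments it joins, and each Z, CZ or CCZ gate contributes the product of the variables of the one, two or three segments on which it acts. For $L\in GL_n(\mathbb{F}_2)$ put $f_C^L(x)=f_C(Lx)$. There is a classical deterministic algorithm (a multi-tape Turing machine) such that for every polynomial $p$ there is a polynomial $q$ with the following property. For every $\ell$ and every circuit $C$ as above on $\ell$ qubits with at most $p(\ell)$ gates, the algorithm, given only a description of $C$, outputs an exact description of $\langle 0|C|0\rangle$ (where $|0\rangle=|0\rangle^{\otimes\ell}$), in the form of integers $a$ and $k\ge 0$ with $\langle 0|C|0\rangle=a/\sqrt2^{\,k}$; and whenever there exists $L\in GL_n(\mathbb{F}_2)$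 such that $f_C^L$ depends on at most $v$ variables, it does so within $2^v\,q(\ell)$ steps. -/

import Mathlib

/-- A gate from the set {Hadamard, Z, CZ, CCZ}, acting on named wires of an `ℓ`-qubit register;
the wires on which one gate acts are distinct. -/
inductive QGate (ℓ : ℕ) : Type
  | H (i : Fin ℓ)
  | Z (i : Fin ℓ)
  | CZ (i j : Fin ℓ) (hij : i ≠ j)
  | CCZ (i j k : Fin ℓ) (hij : i ≠ j) (hik : i ≠ k) (hjk : j ≠ k)

/-- Computational basis states of `ℓ` qubits. -/
abbrev QBasis (ℓ : ℕ) : Type := Fin ℓ → Fin 2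

/-- The `2 × 2` Hadamard matrix. -/
noncomputable def hadamardMatrix : Matrix (Fin 2) (Fin 2) ℂ :=
  ((Real.sqrt 2 : ℝ) : ℂ)⁻¹ • !![1, 1; 1, -1]

namespace QGate

variable {ℓ : ℕ}

/-- The unitary matrix of a gate on the whole register, in the computational basis: a Hadamard
gate acts as `hadamardMatrix` on its wire and as the identity on the others; the other gates are
diagonal, and change the sign of the basis states that are 1 on all the wires they act on. -/
noncomputable def toMatrix : QGate ℓ → Matrix (QBasis ℓ) (QBasis ℓ) ℂ
  | H i => Matrix.of fun x y =>
      if ∀ j, j ≠ i → x j = y j then hadamardMatrix (x i) (y i) else 0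
  | Z i => Matrix.diagonal fun x => if x i = 1 then -1 else 1
  | CZ i j _ => Matrix.diagonal fun x => if x i = 1 ∧ x j = 1 then -1 else 1
  | CCZ i j k _ _ _ => Matrix.diagonal fun x => if x i = 1 ∧ x j = 1 ∧ x k = 1 then -1 else 1

/-- Is this gate a Hadamard gate on wire `i`? -/
def isHadamardOn : QGate ℓ → Fin ℓ → Bool
  | H j, i => decide (j = i)
  | _, _ => false

end QGate

/-- The number of Hadamard gates on wire `i` in a list of gates. -/
def hadamardCount {ℓ : ℕ} (gs : List (QGate ℓ)) (i : Fin ℓ) : ℕ :=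
  gs.countP fun g => g.isHadamardOn i

/-- A quantum circuit on `ℓ` qubits that begins and ends with a column of Hadamard gates (one on
each qubit). The gates between the two columns are recorded in order of time. -/
structure QCircuit (ℓ : ℕ) : Type where
  internal : List (QGate ℓ)

namespace QCircuit

variable {ℓ : ℕ}

/-- All gates of the circuit in order of time, the two columns of Hadamards included. -/
def gates (C : QCircuit ℓ) : List (QGate ℓ) :=
  (List.finRange ℓ).map QGate.H ++ C.internal ++ (List.finRange ℓ).map QGate.H

/-- The number of gates of the circuit. -/
def size (C : QCircuit ℓ) : ℕ := C.gates.length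

/-- The unitary matrix of the circuit: the first gate is applied first. -/
noncomputable def unitary (C : QCircuit ℓ) : Matrix (QBasis ℓ) (QBasis ℓ) ℂ :=
  C.gates.foldl (fun U g => g.toMatrix * U) 1

/-- The amplitude `⟨0|C|0⟩`. -/
noncomputable def amplitude (C : QCircuit ℓ) : ℂ := C.unitary 0 0

/-- Wire segments of the internal part, which index the variables of the polynomial of `C`: the
Hadamard gates on wire `i` cut it into one more segment than there are such gates. The number of
segments is the number of internal Hadamard gates plus `ℓ`. -/
abbrev Segment (C : QCircuit ℓ) : Type :=
  Σ i : Fin ℓ, Fin (hadamardCount C.internal i + 1)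

/-- The segment of wire `i` that has been reached once the first `t` internal gates are done. -/
def segmentAt (C : QCircuit ℓ) (t : ℕ) (i : Fin ℓ) : C.Segment :=
  ⟨i, ⟨hadamardCount (C.internal.take t) i,
    Nat.lt_succ_of_le ((List.take_sublist t C.internal).countP_le)⟩⟩

open MvPolynomial in
/-- The monomial of a gate which is the internal gate number `t` (counted from 0). A Hadamard gate
gives the product of the variables of the two segments that it joins. -/
noncomputable def term (C : QCircuit ℓ) (t : ℕ) : QGate ℓ → MvPolynomial C.Segment (ZMod 2)
  | .H i => X (C.segmentAt t i) * X (C.segmentAt (t + 1) i)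
  | .Z i => X (C.segmentAt t i)
  | .CZ i j _ => X (C.segmentAt t i) * X (C.segmentAt t j)
  | .CCZ i j k _ _ _ => X (C.segmentAt t i) * X (C.segmentAt t j) * X (C.segmentAt t k)

/-- The polynomial `f_C` over `𝔽₂`: the sum of the monomials of the internal gates. -/
noncomputable def polynomial (C : QCircuit ℓ) : MvPolynomial C.Segment (ZMod 2) :=
  ∑ t : Fin C.internal.length, C.term t (C.internal.get t)

/-- `f_C` as a function on `𝔽₂ⁿ`. -/
noncomputable def polyFun (C : QCircuit ℓ) (x : C.Segment → ZMod 2) : ZMod 2 :=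
  MvPolynomial.eval x C.polynomial

end QCircuit

/-- `f^L(x) = f(Lx)` for an invertible linear transformation `L` over `𝔽₂`. -/
def linTransform {ι : Type} [Fintype ι] [DecidableEq ι] (f : (ι → ZMod 2) → ZMod 2)
    (L : GL ι (ZMod 2)) (x : ι → ZMod 2) : ZMod 2 :=
  f (Matrix.mulVec (L : Matrix ι ι (ZMod 2)) x)

/-- The alphabet in which circuits are written down. -/
inductive CircuitSymbol : Type
  | tally | sep | tagH | tagZ | tagCZ | tagCCZ

/-- A number in unary, with an end mark. All numbers in the description of a circuit on `ℓ` qubits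
are at most `ℓ`, so this is at most polynomially longer in `ℓ` than any other notation. -/
def encodeUnary (n : ℕ) : List CircuitSymbol :=
  List.replicate n CircuitSymbol.tally ++ [CircuitSymbol.sep]

/-- The description of a gate: its name and the wires on which it acts. -/
def QGate.encode {ℓ : ℕ} : QGate ℓ → List CircuitSymbol
  | H i => CircuitSymbol.tagH :: encodeUnary i
  | Z i => CircuitSymbol.tagZ :: encodeUnary i
  | CZ i j _ => CircuitSymbol.tagCZ :: (encodeUnary i ++ encodeUnary j)
  | CCZ i j k _ _ _ =>
      CircuitSymbol.tagCCZ :: (encodeUnary i ++ encodeUnary j ++ encodeUnary k)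

/-- The description of a circuit: the number of qubits, then all gates (the two columns of
Hadamards included) in order of time. -/
def QCircuit.encode {ℓ : ℕ} (C : QCircuit ℓ) : List CircuitSymbol :=
  encodeUnary ℓ ++ C.gates.flatMap QGate.encode

/-- The output format for the number `a / (√2)ᵏ`: `k` copies of `none`, then the sign of `a` (`true`
if negative), then the binary digits of `|a|`, least significant digit first. -/
def encodeAmplitude (a : ℤ) (k : ℕ) : List (Option Bool) :=
  List.replicate k none ++ some (decide (a < 0)) :: (Nat.bits a.natAbs).map some

/-- The multi-tape (multi-stack) Turing machine `M`, started with the description of `C` as its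
only input, halts after at most `T` steps with an exact description of `⟨0|C|0⟩` as its output. -/
def ComputesAmplitudeInTime (M : Turing.TM2ComputableAux CircuitSymbol (Option Bool))
    {ℓ : ℕ} (C : QCircuit ℓ) (T : ℕ) : Prop :=
  ∃ (a : ℤ) (k : ℕ), C.amplitude = (a : ℂ) / ((Real.sqrt 2 : ℝ) : ℂ) ^ k ∧
    Nonempty (Turing.TM2OutputsInTime M.tm
      (C.encode.map M.inputAlphabet.symm)
      (some ((encodeAmplitude a k).map M.outputAlphabet.symm)) T)

/-! Inserting basis states along the circuit writes $\langle 0|C|0\rangle$ as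
$\sqrt2^{-(n+\ell)}\sum_{y\in\mathbb F_2^n}(-1)^{f(y)}$, with one variable for each Hadamard gate
outside the last column; the outputs of the last column are fixed to zero (`zeroAmplitude_append`,
`QCircuit.amplitude_eq`). The phase $f$ is `pathFun`. It equals $f_C$ composed with an additive map
from paths to values of the segments (`QCircuit.polyFun_segmentVec`), and it has degree at most
three, because a gate contributes a product of at most three linear forms (`degLT_pathFun`).

Let $W$ be the space of periods of $f$, the $w$ with $f(y+w)=f(y)$ for all $y$. If $f_C^L$ depends
on at most $v$ variables, then $W$ has codimension at most $v$. The algorithm needs neither $L$ nor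
$v$; it finds a complement of $W$ spanned by unit vectors. Two facts make this cheap enough.

Membership in $W$ is decided in polynomial time: $y\mapsto f(y+w)+f(y)$ has degree at most two, so
it vanishes identically as soon as it vanishes at all vectors of weight at most two
(`DegLT.eq_zero_of_quad`, `quadTest_iff`).

A set $B$ of coordinates is grown greedily: the next unit vector is added unless it is congruent
modulo $W$ to a vector supported on $B$, which is decided by trying all $2^{|B|}$ such vectors. No
nonzero period is ever supported on $B$ (`greedy_independent`), so $|B|\le v$ at every stage
(`numSelected_greedy_le`); at the end every vector is congruent to one supported on $B$
(`greedy_spanning`). As $f$ is constant on cosets of $W$, the sum is $2^{n-|B|}(n_0-n_1)$, where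
$n_0,n_1$ count the assignments on $B$ with phase 0 and 1 (`sum_phaseSign`).

The machine is compiled from structured programs in which only loop tests cost time
(`Cmd.Exec.iterate_step`). The total time is at most an affine function of $2^v$ with coefficients
polynomial in $\ell$ (`runtimeBound`). -/

/-! ### Structured programs and their compilation to stack machines -/

/-- Sequential programs over finitely many stacks with a finite register: the source language
of the machine. -/
inductive Cmd {K : Type} (Γ : K → Type) (σ : Type) : Type
  | skip
  | push (k : K) (f : σ → Γ k)
  | pop (k : K) (f : σ → Option (Γ k) → σ)
  | load (f : σ → σ)
  | seq (a b : Cmd Γ σ)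
  | ite (p : σ → Bool) (a b : Cmd Γ σ)
  | loop (p : σ → Bool) (a : Cmd Γ σ)

namespace Cmd

variable {K : Type} {Γ : K → Type} {σ : Type}

/-- The loops of a program, which become the labels of the compiled machine. -/
def Loc : Cmd Γ σ → Type
  | skip | push _ _ | pop _ _ | load _ => Empty
  | seq a b => a.Loc ⊕ b.Loc
  | ite _ a b => a.Loc ⊕ b.Loc
  | loop _ a => Option a.Loc

/-- A program has finitely many loops. -/
@[reducible] def locFintype : (c : Cmd Γ σ) → Fintype c.Loc
  | skip | push _ _ | pop _ _ | load _ => inferInstanceAs (Fintype Empty)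
  | seq a b => by
      letI := a.locFintype; letI := b.locFintype; exact inferInstanceAs (Fintype (a.Loc ⊕ b.Loc))
  | ite _ a b => by
      letI := a.locFintype; letI := b.locFintype; exact inferInstanceAs (Fintype (a.Loc ⊕ b.Loc))
  | loop _ a => by
      letI := a.locFintype; exact inferInstanceAs (Fintype (Option a.Loc))

/-- The statement that runs a program and continues with `q`; `e` names the labels. -/
def code {Λ : Type} : (c : Cmd Γ σ) → (c.Loc → Λ) → Turing.TM2.Stmt Γ Λ σ → Turing.TM2.Stmt Γ Λ σ
  | skip, _, q => q
  | push k f, _, q => .push k f q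
  | pop k f, _, q => .pop k f q
  | load f, _, q => .load f q
  | seq a b, e, q => a.code (fun l => e (Sum.inl l)) (b.code (fun l => e (Sum.inr l)) q)
  | ite p a b, e, q =>
      .branch p (a.code (fun l => e (Sum.inl l)) q) (b.code (fun l => e (Sum.inr l)) q)
  | loop _ _, e, _ => .goto fun _ => e none

/-- The statements at the labels of a program. -/
def table {Λ : Type} :
    (c : Cmd Γ σ) → (c.Loc → Λ) → Turing.TM2.Stmt Γ Λ σ → c.Loc → Turing.TM2.Stmt Γ Λ σ
  | skip, _, _, l | push _ _, _, _, l | pop _ _, _, _, l | load _, _, _, l => nomatch l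
  | seq a b, e, q, .inl l =>
      a.table (fun l => e (Sum.inl l)) (b.code (fun l => e (Sum.inr l)) q) l
  | seq _ b, e, q, .inr l => b.table (fun l => e (Sum.inr l)) q l
  | ite _ a _, e, q, .inl l => a.table (fun l => e (Sum.inl l)) q l
  | ite _ _ b, e, q, .inr l => b.table (fun l => e (Sum.inr l)) q l
  | loop p a, e, q, none => .branch p (a.code (fun l => e (some l)) (.goto fun _ => e none)) q
  | loop _ a, e, _, some l => a.table (fun l => e (some l)) (.goto fun _ => e none) l

variable [DecidableEq K]

/-- Big-step semantics. The last argument counts the tests of loop conditions. -/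
inductive Exec : Cmd Γ σ → σ × (∀ k, List (Γ k)) → σ × (∀ k, List (Γ k)) → ℕ → Prop
  | skip {s} : Exec skip s s 0
  | push {k f v S} : Exec (push k f) (v, S) (v, Function.update S k (f v :: S k)) 0
  | pop {k f v S} :
      Exec (pop k f) (v, S) (f v (S k).head?, Function.update S k (S k).tail) 0
  | load {f v S} : Exec (load f) (v, S) (f v, S) 0
  | seq {a b s s' s'' t t'} : Exec a s s' t → Exec b s' s'' t' → Exec (seq a b) s s'' (t + t')
  | iteTrue {p a b s s' t} : p s.1 = true → Exec a s s' t → Exec (ite p a b) s s' t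
  | iteFalse {p a b s s' t} : p s.1 = false → Exec b s s' t → Exec (ite p a b) s s' t
  | loopFalse {p a s} : p s.1 = false → Exec (loop p a) s s 1
  | loopTrue {p a s s' s'' t t'} : p s.1 = true → Exec a s s' t → Exec (loop p a) s' s'' t' →
      Exec (loop p a) s s'' (t + t' + 1)

/-- A machine step runs a whole statement up to the next jump, and compiled code jumps only to loop
heads. Hence the number of loop tests is exactly the number of steps between the entry of `c` and
the entry of its continuation `q`. -/
theorem Exec.iterate_step {Λ : Type} {m : Λ → Turing.TM2.Stmt Γ Λ σ} {c : Cmd Γ σ}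
    {s s' : σ × (∀ k, List (Γ k))} {t : ℕ} (h : Exec c s s' t) :
    ∀ (e : c.Loc → Λ) (q : Turing.TM2.Stmt Γ Λ σ), (∀ l, m (e l) = c.table e q l) →
      (flip bind (Turing.TM2.step m))^[t] (some (Turing.TM2.stepAux (c.code e q) s.1 s.2)) =
        some (Turing.TM2.stepAux q s'.1 s'.2) := by
  induction h with
  | skip | push | pop | load => intro e q _; rfl
  | seq _ _ iha ihb =>
    intro e q hm
    rw [add_comm, Function.iterate_add_apply, code, iha _ _ fun l => hm (.inl l),
      ihb _ _ fun l => hm (.inr l)]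
  | iteTrue hp _ ih =>
    intro e q hm
    rw [code, Turing.TM2.stepAux, hp, cond_true, ih _ _ fun l => hm (.inl l)]
  | iteFalse hp _ ih =>
    intro e q hm
    rw [code, Turing.TM2.stepAux, hp, cond_false, ih _ _ fun l => hm (.inr l)]
  | loopFalse hp =>
    intro e q hm
    change some (Turing.TM2.stepAux (m (e none)) _ _) = _
    rw [hm none, table, Turing.TM2.stepAux, hp, cond_false]
  | loopTrue hp _ _ iha ihb =>
    intro e q hm
    rw [Function.iterate_succ_apply]
    change (flip bind (Turing.TM2.step m))^[_] (some (Turing.TM2.stepAux (m (e none)) _ _)) = _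
    rw [hm none, table, Turing.TM2.stepAux, hp, cond_true, add_comm, Function.iterate_add_apply,
      iha _ _ fun l => hm (some l)]
    exact ihb e q hm

end Cmd

/-! ### Stacks, alphabets and register -/

/-- A cell of the work tape of the machine. There is one cell for each variable of the path sum. -/
structure TapeCell : Type where
  /-- the value of the variable in the current assignment -/
  x : Bool
  /-- has the variable been selected? -/
  b : Bool
  /-- is the variable the candidate that is examined? -/
  i : Bool
  /-- does the first pointer stand here? -/
  p : Bool
  /-- does the second pointer stand here? -/
  q : Bool

/-- The stacks of the machine. -/
inductive StackName : Type
  | inp | out | gate | gateAux | tape | tapeAux | wire | wireAux | una | unaAux | bits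
  deriving DecidableEq

/-- The alphabets of the stacks. -/
abbrev StackAlphabet : StackName → Type
  | .inp | .gate | .gateAux => CircuitSymbol
  | .out => Option Bool
  | .tape | .tapeAux => TapeCell
  | .wire | .wireAux | .una | .unaAux | .bits => Bool

/-- The finite register of the machine. -/
structure Reg : Type where
  sym : Option CircuitSymbol := none
  cell : Option TapeCell := none
  bit : Option Bool := none
  bit' : Option Bool := none
  rem : Fin 3 := 0
  acc : Bool := false
  isH : Bool := false
  ph : Bool := false
  ok : Bool := false
  found : Bool := false
  carry : Bool := false
  pi : Bool := true
  pp : Bool := true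
  pq : Bool := true

/-- The contents of all stacks. -/
structure Mem : Type where
  inp : List CircuitSymbol := []
  out : List (Option Bool) := []
  gate : List CircuitSymbol := []
  gateAux : List CircuitSymbol := []
  tape : List TapeCell := []
  tapeAux : List TapeCell := []
  wire : List Bool := []
  wireAux : List Bool := []
  una : List Bool := []
  unaAux : List Bool := []
  bits : List Bool := []

noncomputable instance : Fintype StackName :=
  Fintype.ofSurjective (fun j : Fin 11 => match j with
    | 0 => .inp | 1 => .out | 2 => .gate | 3 => .gateAux | 4 => .tape | 5 => .tapeAux
    | 6 => .wire | 7 => .wireAux | 8 => .una | 9 => .unaAux | 10 => StackName.bits)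
    (by
      rintro (_ | _)
      exacts [⟨0, rfl⟩, ⟨1, rfl⟩, ⟨2, rfl⟩, ⟨3, rfl⟩, ⟨4, rfl⟩, ⟨5, rfl⟩, ⟨6, rfl⟩, ⟨7, rfl⟩,
        ⟨8, rfl⟩, ⟨9, rfl⟩, ⟨10, rfl⟩])

open Classical in
noncomputable instance : Fintype CircuitSymbol :=
  Fintype.ofSurjective (fun j : Fin 6 => match j with
    | 0 => .tally | 1 => .sep | 2 => .tagH | 3 => .tagZ | 4 => .tagCZ | 5 => CircuitSymbol.tagCCZ)
    (by rintro (_ | _); exacts [⟨0, rfl⟩, ⟨1, rfl⟩, ⟨2, rfl⟩, ⟨3, rfl⟩, ⟨4, rfl⟩, ⟨5, rfl⟩])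

noncomputable instance : Fintype TapeCell :=
  Fintype.ofInjective (fun c => (c.x, c.b, c.i, c.p, c.q)) (by
    rintro ⟨⟩ ⟨⟩ h; simp_all)

noncomputable instance : Fintype Reg :=
  Fintype.ofInjective (fun v => (v.sym, v.cell, v.bit, v.bit', v.rem, (v.acc, v.isH, v.ph, v.ok),
    v.found, v.carry, v.pi, v.pp, v.pq)) (by rintro ⟨⟩ ⟨⟩ h; simp_all)

namespace Mem

/-- The contents of a stack. -/
def get (m : Mem) : (k : StackName) → List (StackAlphabet k)
  | .inp => m.inp
  | .out => m.out
  | .gate => m.gate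
  | .gateAux => m.gateAux
  | .tape => m.tape
  | .tapeAux => m.tapeAux
  | .wire => m.wire
  | .wireAux => m.wireAux
  | .una => m.una
  | .unaAux => m.unaAux
  | .bits => m.bits

/-- Replace the contents of a stack. -/
def set (m : Mem) : (k : StackName) → List (StackAlphabet k) → Mem
  | .inp, l => { m with inp := l }
  | .out, l => { m with out := l }
  | .gate, l => { m with gate := l }
  | .gateAux, l => { m with gateAux := l }
  | .tape, l => { m with tape := l }
  | .tapeAux, l => { m with tapeAux := l }
  | .wire, l => { m with wire := l }
  | .wireAux, l => { m with wireAux := l }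
  | .una, l => { m with una := l }
  | .unaAux, l => { m with unaAux := l }
  | .bits, l => { m with bits := l }

/-- Links the record of stacks, whose updates reduce definitionally, to the dependent functions that
the machine model uses. -/
theorem get_set (m : Mem) (k : StackName) (l : List (StackAlphabet k)) :
    (m.set k l).get = Function.update m.get k l := by
  funext j
  cases k <;> cases j <;> rfl

end Mem

/-! ### Runs of programs with time bounds -/

/-- The programs of the machine. -/
abbrev Prg : Type := Cmd StackAlphabet Reg

/-- A configuration during the run of a program. -/
structure Conf : Type where
  reg : Reg := {}
  mem : Mem := {}

/-- The program `c`, started in `s`, ends in `s'` after at most `t` tests of loop conditions. -/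
def Runs (c : Prg) (s s' : Conf) (t : ℕ) : Prop :=
  ∃ t' ≤ t, Cmd.Exec c (s.reg, s.mem.get) (s'.reg, s'.mem.get) t'

infixr:60 " ;; " => Cmd.seq

namespace Runs

variable {s s' s'' : Conf} {t t' : ℕ} {a b : Prg} {p : Reg → Bool}

theorem mono (h : Runs a s s' t) (ht : t ≤ t') : Runs a s s' t' :=
  let ⟨u, hu, e⟩ := h
  ⟨u, hu.trans ht, e⟩

theorem skip : Runs .skip s s 0 := ⟨0, le_rfl, .skip⟩

theorem seq (h : Runs a s s' t) (h' : Runs b s' s'' t') : Runs (a ;; b) s s'' (t + t') :=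
  let ⟨u, hu, e⟩ := h
  let ⟨u', hu', e'⟩ := h'
  ⟨u + u', Nat.add_le_add hu hu', .seq e e'⟩

theorem iteTrue (hp : p s.reg = true) (h : Runs a s s' t) : Runs (.ite p a b) s s' t :=
  let ⟨u, hu, e⟩ := h
  ⟨u, hu, .iteTrue hp e⟩

theorem iteFalse (hp : p s.reg = false) (h : Runs b s s' t) : Runs (.ite p a b) s s' t :=
  let ⟨u, hu, e⟩ := h
  ⟨u, hu, .iteFalse hp e⟩

theorem loopFalse (hp : p s.reg = false) : Runs (.loop p a) s s 1 := ⟨1, le_rfl, .loopFalse hp⟩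

theorem loopTrue (hp : p s.reg = true) (h : Runs a s s' t) (h' : Runs (.loop p a) s' s'' t') :
    Runs (.loop p a) s s'' (t + t' + 1) :=
  let ⟨u, hu, e⟩ := h
  let ⟨u', hu', e'⟩ := h'
  ⟨u + u' + 1, by omega, .loopTrue hp e e'⟩

end Runs

namespace Cmd

/-- Does a program contain no loop? -/
def loopFree : Prg → Bool
  | .seq a b | .ite _ a b => a.loopFree && b.loopFree
  | .loop _ _ => false
  | _ => true

/-- The effect of a program without loops. -/
def eval : Prg → Conf → Conf
  | .skip, s => s
  | .push k f, ⟨v, m⟩ => ⟨v, m.set k (f v :: m.get k)⟩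
  | .pop k f, ⟨v, m⟩ => ⟨f v (m.get k).head?, m.set k (m.get k).tail⟩
  | .load f, ⟨v, m⟩ => ⟨f v, m⟩
  | .seq a b, s => b.eval (a.eval s)
  | .ite p a b, s => bif p s.reg then a.eval s else b.eval s
  | .loop _ _, s => s

end Cmd

/-- Code without loops costs nothing, so its run can be found by evaluation; `Runs.straight` is
mostly applied with `rfl`. -/
theorem Runs.eval : ∀ {c : Prg}, c.loopFree = true → ∀ s, Runs c s (c.eval s) 0
  | .skip, _, s => .skip
  | .push k f, _, ⟨v, m⟩ => ⟨0, le_rfl, by rw [Cmd.eval, Mem.get_set]; exact .push⟩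
  | .pop k f, _, ⟨v, m⟩ => ⟨0, le_rfl, by rw [Cmd.eval, Mem.get_set]; exact .pop⟩
  | .load f, _, ⟨v, m⟩ => ⟨0, le_rfl, .load⟩
  | .seq a b, h, s => by
      rw [Cmd.loopFree, Bool.and_eq_true] at h
      exact (Runs.eval h.1 s).seq (Runs.eval h.2 _)
  | .ite p a b, h, s => by
      rw [Cmd.loopFree, Bool.and_eq_true] at h
      rw [Cmd.eval]
      cases hp : p s.reg
      · exact .iteFalse hp (Runs.eval h.2 s)
      · exact .iteTrue hp (Runs.eval h.1 s)
  | .loop _ _, h, _ => by cases h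

theorem Runs.straight {c : Prg} {s s' : Conf} (h : c.loopFree = true) (e : c.eval s = s') :
    Runs c s s' 0 := e ▸ Runs.eval h s

/-! ### Loops over a stack and loops with exit test -/

/-- Pop the symbols of a stack one after the other and run `body` after each of them. -/
def forEach (k : StackName) (f : Reg → Option (StackAlphabet k) → Reg) (p : Reg → Bool)
    (body : Prg) : Prg :=
  .pop k f ;; .loop p (body ;; .pop k f)

theorem runs_forEach_nil {k : StackName} {f : Reg → Option (StackAlphabet k) → Reg}
    {p : Reg → Bool} {body : Prg} {v : Reg} {m : Mem} (hk : m.get k = [])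
    (hp : p (f v none) = false) : Runs (forEach k f p body) ⟨v, m⟩ ⟨f v none, m⟩ 1 := by
  refine ((Runs.straight (c := .pop k f) rfl (s' := ⟨f v none, m⟩) ?_).seq
    (Runs.loopFalse hp)).mono le_rfl
  rw [Cmd.eval, hk, List.head?_nil, List.tail_nil]
  congr 1
  cases k <;> cases m <;> simp_all [Mem.set, Mem.get]

/-- The pop at the end of the loop body is also the opening pop of the remaining `forEach`. The run
of the latter is therefore cut after its first command and reassembled. -/
theorem runs_forEach_cons {k : StackName} {f : Reg → Option (StackAlphabet k) → Reg}
    {p : Reg → Bool} {body : Prg} {v : Reg} {m : Mem} {a : StackAlphabet k}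
    {l : List (StackAlphabet k)} {s s' : Conf} {t t' : ℕ} (hk : m.get k = a :: l)
    (hp : p (f v (some a)) = true) (h : Runs body ⟨f v (some a), m.set k l⟩ s t)
    (h' : Runs (forEach k f p body) s s' t') :
    Runs (forEach k f p body) ⟨v, m⟩ s' (t + t' + 1) := by
  obtain ⟨u, hu, e⟩ := h
  obtain ⟨u', hu', e'⟩ := h'
  cases e' with
  | @seq _ _ _ s₁ _ t₁ t₂ e₁ e₂ =>
    refine ⟨0 + (u + t₁ + t₂ + 1), by omega, .seq (s' := (f v (some a), (m.set k l).get)) ?_ ?_⟩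
    · rw [Mem.get_set]
      simpa [hk] using Cmd.Exec.pop (K := StackName) (f := f) (v := v) (S := m.get) (k := k)
    · exact .loopTrue hp (.seq e e₁) e₂

/-- Run `c` until `p` holds, at least once. -/
def repeatUntil (p : Reg → Bool) (c : Prg) : Prg := c ;; .loop (fun v => !p v) c

/-- The loop invariant is given as an explicit sequence of configurations. Cyclic sweeps are
modelled by sequences whose last member, at `N + 1`, is back at the start, which is why the test
comes after the body. -/
theorem runs_repeatUntil {p : Reg → Bool} {c : Prg} {N T : ℕ} (s : ℕ → Conf)
    (hrun : ∀ j ≤ N, Runs c (s j) (s (j + 1)) T) (hfalse : ∀ j < N, p (s (j + 1)).reg = false)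
    (htrue : p (s (N + 1)).reg = true) :
    Runs (repeatUntil p c) (s 0) (s (N + 1)) ((N + 1) * (T + 1)) := by
  -- Here `j` counts the rounds still to be done, so that the induction starts at the exit of the
  -- loop.
  suffices h : ∀ j ≤ N, Runs (.loop (fun v => !p v) c) (s (N + 1 - j)) (s (N + 1))
      (j * (T + 1) + 1) by
    have h₁ := h N le_rfl
    rw [Nat.add_sub_cancel_left] at h₁
    exact ((hrun 0 (Nat.zero_le _)).seq h₁).mono (by ring_nf; omega)
  intro j hj
  induction j with
  | zero => exact (Runs.loopFalse (by simp [htrue])).mono (by omega)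
  | succ j ih =>
    have e : N + 1 - (j + 1) = N - (j + 1) + 1 := by omega
    refine (Runs.loopTrue (s' := s (N + 1 - j)) ?_ ?_ (ih (by omega))).mono (t := T + _ + 1)
      (by ring_nf; omega)
    · simp only [e, hfalse (N - (j + 1)) (by omega), Bool.not_false]
    · have := hrun (N - (j + 1) + 1) (by omega)
      rwa [← e, show N + 1 - (j + 1) + 1 = N + 1 - j by omega] at this

theorem Runs.of {c : Prg} {s s₁ s' : Conf} {t t' : ℕ} (h : Runs c s s₁ t) (e : s₁ = s')
    (ht : t ≤ t') : Runs c s s' t' := e ▸ h.mono ht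

namespace Mem

theorem get_set_self (m : Mem) (k : StackName) (l : List (StackAlphabet k)) :
    (m.set k l).get k = l := by rw [get_set, Function.update_self]

theorem get_set_of_ne (m : Mem) {k j : StackName} (h : j ≠ k) (l : List (StackAlphabet k)) :
    (m.set k l).get j = m.get j := by rw [get_set, Function.update_of_ne h]

theorem set_get (m : Mem) (k : StackName) : m.set k (m.get k) = m := by cases k <;> rfl

theorem set_set (m : Mem) (k : StackName) (l l' : List (StackAlphabet k)) :
    (m.set k l).set k l' = m.set k l' := by cases k <;> rfl

theorem set_comm (m : Mem) {k j : StackName} (h : j ≠ k) (l : List (StackAlphabet k))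
    (l' : List (StackAlphabet j)) : (m.set k l).set j l' = (m.set j l').set k l := by
  cases k <;> cases j <;> first | rfl | exact absurd rfl h

end Mem

/-- Moving a stack symbol by symbol to another one, with a translation of the symbols. -/
theorem runs_transfer {k j : StackName} (hkj : j ≠ k) {f : Reg → Option (StackAlphabet k) → Reg}
    {p : Reg → Bool} {g : Reg → StackAlphabet j} (g' : StackAlphabet k → StackAlphabet j)
    (hg : ∀ v a, g (f v (some a)) = g' a) (hf : ∀ v o o', f (f v o) o' = f v o')
    (hp : ∀ v o, p (f v o) = o.isSome) (v : Reg) (m : Mem) :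
    Runs (forEach k f p (.push j g)) ⟨v, m⟩
      ⟨f v none, (m.set k []).set j (((m.get k).map g').reverse ++ m.get j)⟩
      ((m.get k).length + 1) := by
  obtain ⟨l, hl⟩ : ∃ l, m.get k = l := ⟨_, rfl⟩
  induction l generalizing v m with
  | nil =>
    refine (runs_forEach_nil hl (hp v none)).of ?_ (Nat.le_add_left _ _)
    rw [hl, List.map_nil, List.reverse_nil, List.nil_append,
      ← m.get_set_of_ne hkj [], Mem.set_get, ← hl, Mem.set_get]
  | cons a l ih =>
    have ih := ih (f v (some a)) ((m.set k l).set j (g (f v (some a)) :: (m.set k l).get j))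
      (by rw [Mem.get_set_of_ne _ hkj.symm, Mem.get_set_self])
    refine (runs_forEach_cons hl (hp _ _) (Runs.straight rfl rfl) ih).of ?_ ?_
    · rw [hf, hl, Mem.get_set_self, Mem.get_set_of_ne _ hkj.symm, Mem.get_set_self,
        Mem.get_set_of_ne _ hkj, hg, Mem.set_comm _ hkj.symm, Mem.set_set, Mem.set_set]
      simp
    · rw [Mem.get_set_of_ne _ hkj.symm, Mem.get_set_self, hl, List.length_cons]
      omega

/-! ### Rewinding and rewriting stacks -/

/-- An empty cell. -/
def TapeCell.blank : TapeCell := ⟨false, false, false, false, false⟩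

namespace Reg

/-- Put a popped symbol into the register. -/
def setSym (v : Reg) (o : Option CircuitSymbol) : Reg := { v with sym := o }

/-- Put a popped cell into the register. -/
def setCell (v : Reg) (o : Option TapeCell) : Reg := { v with cell := o }

/-- Put a popped bit into the register. -/
def setBit (v : Reg) (o : Option Bool) : Reg := { v with bit := o }

/-- The cell in the register. -/
def cellD (v : Reg) : TapeCell := v.cell.getD .blank

/-- The bit in the register. -/
def bitD (v : Reg) : Bool := v.bit.getD false

/-- The symbol in the register. -/
def symD (v : Reg) : CircuitSymbol := v.sym.getD .sep

end Reg

/-- Move the gate description back from the auxiliary stack. -/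
def rewindGate : Prg :=
  forEach .gateAux Reg.setSym (fun v => v.sym.isSome) (.push .gate Reg.symD)

/-- Move the tape back from the auxiliary stack. -/
def rewindTape : Prg :=
  forEach .tapeAux Reg.setCell (fun v => v.cell.isSome) (.push .tape Reg.cellD)

/-- Move the wires back from the auxiliary stack. -/
def rewindWire : Prg :=
  forEach .wireAux Reg.setBit (fun v => v.bit.isSome) (.push .wire Reg.bitD)

/-- Set all wires to zero. -/
def clearWire : Prg :=
  forEach .wire Reg.setBit (fun v => v.bit.isSome) (.push .wireAux fun _ => false) ;; rewindWire

/-- Rewrite the tape cell by cell; the state of the rewriting is kept in `carry`. -/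
def tapePass (f : Bool → TapeCell → Bool × TapeCell) : Prg :=
  forEach .tape Reg.setCell (fun v => v.cell.isSome)
    (.push .tapeAux (fun v => (f v.carry v.cellD).2) ;;
      .load fun v => { v with carry := (f v.carry v.cellD).1 }) ;;
  rewindTape

/-- Rewrite a list from left to right with a state. -/
def List.passState {α σ : Type} (f : σ → α → σ × α) : σ → List α → σ × List α
  | c, [] => (c, [])
  | c, a :: l => ((List.passState f (f c a).1 l).1, (f c a).2 :: (List.passState f (f c a).1 l).2)

theorem List.length_passState {α σ : Type} (f : σ → α → σ × α) (c : σ) (l : List α) :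
    (l.passState f c).2.length = l.length := by
  induction l generalizing c with
  | nil => rfl
  | cons a l ih => simp [passState, ih]

theorem runs_rewindGate (v : Reg) (m : Mem) :
    Runs rewindGate ⟨v, m⟩
      ⟨{ v with sym := none }, { m with gate := m.gateAux.reverse ++ m.gate, gateAux := [] }⟩
      (m.gateAux.length + 1) := by
  have h := runs_transfer (k := .gateAux) (j := .gate) (by decide) (f := Reg.setSym)
    (p := fun v => v.sym.isSome) (g := Reg.symD) id (fun _ _ => rfl) (fun _ _ _ => rfl)
    (fun _ _ => rfl) v m
  rw [List.map_id] at h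
  exact h

theorem runs_rewindTape (v : Reg) (m : Mem) :
    Runs rewindTape ⟨v, m⟩
      ⟨{ v with cell := none }, { m with tape := m.tapeAux.reverse ++ m.tape, tapeAux := [] }⟩
      (m.tapeAux.length + 1) := by
  have h := runs_transfer (k := .tapeAux) (j := .tape) (by decide) (f := Reg.setCell)
    (p := fun v => v.cell.isSome) (g := Reg.cellD) id (fun _ _ => rfl) (fun _ _ _ => rfl)
    (fun _ _ => rfl) v m
  rw [List.map_id] at h
  exact h

theorem runs_rewindWire (v : Reg) (m : Mem) :
    Runs rewindWire ⟨v, m⟩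
      ⟨{ v with bit := none }, { m with wire := m.wireAux.reverse ++ m.wire, wireAux := [] }⟩
      (m.wireAux.length + 1) := by
  have h := runs_transfer (k := .wireAux) (j := .wire) (by decide) (f := Reg.setBit)
    (p := fun v => v.bit.isSome) (g := Reg.bitD) id (fun _ _ => rfl) (fun _ _ _ => rfl)
    (fun _ _ => rfl) v m
  rw [List.map_id] at h
  exact h

theorem runs_clearWire (v : Reg) (m : Mem) (hm : m.wireAux = []) :
    Runs clearWire ⟨v, m⟩
      ⟨{ v with bit := none }, { m with wire := List.replicate m.wire.length false }⟩
      (2 * m.wire.length + 2) := by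
  have h := runs_transfer (k := .wire) (j := .wireAux) (by decide) (f := Reg.setBit)
    (p := fun v => v.bit.isSome) (g := fun _ => false) (fun _ => false) (fun _ _ => rfl)
    (fun _ _ _ => rfl) (fun _ _ => rfl) v m
  refine (h.seq (runs_rewindWire _ _)).of ?_ ?_
  · simp [Mem.get, Mem.set, hm, Reg.setBit]
  · simp [Mem.get, Mem.set, hm]
    omega

theorem runs_tapePass (f : Bool → TapeCell → Bool × TapeCell) (v : Reg) (m : Mem)
    (hm : m.tapeAux = []) :
    Runs (tapePass f) ⟨v, m⟩
      ⟨{ v with cell := none, carry := (m.tape.passState f v.carry).1 },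
        { m with tape := (m.tape.passState f v.carry).2 }⟩ (2 * m.tape.length + 2) := by
  suffices h : ∀ (l : List TapeCell) (v : Reg) (m : Mem), m.tape = l →
      Runs (forEach .tape Reg.setCell (fun v => v.cell.isSome)
        (.push .tapeAux (fun v => (f v.carry v.cellD).2) ;;
          .load fun v => { v with carry := (f v.carry v.cellD).1 })) ⟨v, m⟩
      ⟨{ v with cell := none, carry := (l.passState f v.carry).1 },
        { m with tape := [], tapeAux := (l.passState f v.carry).2.reverse ++ m.tapeAux }⟩
      (l.length + 1) by
    refine ((h _ v m rfl).seq (runs_rewindTape _ _)).of ?_ ?_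
    · simp [hm]
    · simp [hm, List.length_passState]
      omega
  intro l
  induction l with
  | nil =>
    intro v m hl
    refine (runs_forEach_nil (k := .tape) hl rfl).of ?_ (by simp)
    cases m
    simp_all [Reg.setCell, List.passState]
  | cons a l ih =>
    intro v m hl
    refine (runs_forEach_cons (k := .tape) hl rfl (Runs.straight rfl rfl) (ih _ _ rfl)).of ?_ ?_
    · simp [Mem.set, Mem.get, Reg.setCell, Reg.cellD, List.passState]
    · simp

/-! ### The phase of a path and its evaluation from the circuit description -/

namespace QGate

variable {ℓ : ℕ}

/-- The contribution of a gate to the phase of a path; `c` are the values of the wires, and `y` the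
values of the variables that are still to come. -/
def phase : QGate ℓ → (Fin ℓ → Bool) → (ℕ → Bool) → Bool
  | H i, c, y => c i && y 0
  | Z i, c, _ => c i
  | CZ i j _, c, _ => c i && c j
  | CCZ i j k _ _ _, c, _ => c i && c j && c k

/-- The values of the wires after a gate. -/
def wires : QGate ℓ → (Fin ℓ → Bool) → (ℕ → Bool) → Fin ℓ → Bool
  | H i, c, y => Function.update c i (y 0)
  | _, c, _ => c

/-- The variables that are left after a gate. -/
def rest : QGate ℓ → (ℕ → Bool) → ℕ → Bool
  | H _, y => fun j => y (j + 1)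
  | _, y => y

end QGate

/-- The phase of a path through a list of gates. -/
def pathPhase {ℓ : ℕ} : List (QGate ℓ) → (Fin ℓ → Bool) → (ℕ → Bool) → Bool
  | [], _, _ => false
  | g :: gs, c, y => xor (g.phase c y) (pathPhase gs (g.wires c y) (g.rest y))

/-- A list of bits, continued by zeros. -/
def bitSeq (l : List Bool) (j : ℕ) : Bool := l.getD j false

namespace CircuitSymbol

/-- Is this symbol a tally mark? -/
def isTally : CircuitSymbol → Bool
  | tally => true
  | _ => false

/-- Is this symbol an end mark? -/
def isSep : CircuitSymbol → Bool
  | sep => true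
  | _ => false

/-- Is this symbol the name of the Hadamard gate? -/
def isTagH : CircuitSymbol → Bool
  | tagH => true
  | _ => false

/-- The number of arguments of a gate after the first one. -/
def furtherArgs : CircuitSymbol → Fin 3
  | tagCZ => 1
  | tagCCZ => 2
  | _ => 0

end CircuitSymbol

/-- Pass over a wire. -/
def tallyPrg : Prg :=
  .pop .wire Reg.setBit ;; .push .wireAux Reg.bitD ;; .load fun v => { v with bit := none }

/-- Bring the next variable onto the wire. -/
def hadamardPrg (sel : TapeCell → Bool) : Prg :=
  .pop .tape Reg.setCell ;;
  .ite (fun v => v.cell.isSome) (.push .tapeAux Reg.cellD) .skip ;;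
  .load fun v => { v with
    bit := some ((v.cell.map sel).getD false)
    acc := v.acc && (v.cell.map sel).getD false
    cell := none }

/-- Use the wire that has been reached as an argument of the gate. -/
def sepPrg (sel : TapeCell → Bool) : Prg :=
  (.pop .wire Reg.setBit ;;
    .load (fun v => { v with acc := v.acc && v.bitD }) ;;
    .ite (fun v => v.isH) (hadamardPrg sel) .skip ;;
    .push .wire Reg.bitD ;;
    .load (fun v => { v with
      ph := if v.rem = 0 then xor v.ph v.acc else v.ph
      acc := if v.rem = 0 then false else v.acc
      isH := false
      rem := if v.rem = 0 then 0 else v.rem - 1 })) ;;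
  rewindWire

/-- Start a new gate. -/
def tagPrg : Prg :=
  .load fun v => { v with acc := true, isH := v.symD.isTagH, rem := v.symD.furtherArgs }

/-- Interpret one symbol of the description of the gates. -/
def symbolPrg (sel : TapeCell → Bool) : Prg :=
  .ite (fun v => v.symD.isTally) tallyPrg (.ite (fun v => v.symD.isSep) (sepPrg sel) tagPrg) ;;
  .push .gateAux Reg.symD

/-- Interpret the description of the gates. -/
def gatesPrg (sel : TapeCell → Bool) : Prg :=
  forEach .gate Reg.setSym (fun v => v.sym.isSome) (symbolPrg sel)

/-- Add to `ph` the phase of the path that is read from the tape by `sel`. -/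
def phasePrg (sel : TapeCell → Bool) : Prg :=
  gatesPrg sel ;; rewindGate ;; rewindTape ;; clearWire

section

variable {sel : TapeCell → Bool} {v : Reg} {m : Mem} {s : Conf} {t : ℕ}

/-- The first pop overwrites `sym`, so its old value is immaterial; configurations between two
symbols need to agree only up to it. -/
theorem runs_gatesPrg_setSym (o : Option CircuitSymbol)
    (h : Runs (gatesPrg sel) ⟨{ v with sym := o }, m⟩ s t) : Runs (gatesPrg sel) ⟨v, m⟩ s t := by
  obtain ⟨u, hu, e⟩ := h
  cases e with
  | seq e₁ e₂ =>
    cases e₁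
    exact ⟨_, hu, .seq .pop e₂⟩

/-- The remaining run is a hypothesis, here and in the following lemmas, so that the treatments of
single symbols chain into those of arguments and gates. -/
theorem runs_gatesPrg_tally {g : List CircuitSymbol} {b : Bool} {w : List Bool}
    (hg : m.gate = .tally :: g) (hw : m.wire = b :: w) (hb : v.bit = none)
    (h : Runs (gatesPrg sel) ⟨v, { m with gate := g, gateAux := .tally :: m.gateAux, wire := w,
                                          wireAux := b :: m.wireAux }⟩ s t) :
    Runs (gatesPrg sel) ⟨v, m⟩ s (t + 1) := by
  refine (runs_forEach_cons (k := .gate) hg rfl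
    ((Runs.iteTrue rfl (Runs.straight rfl rfl)).seq (Runs.straight rfl rfl))
    (runs_gatesPrg_setSym (sel := sel) none (t := t) (s := s) ?_)).mono (by omega)
  refine Eq.subst (motive := fun s' => Runs (gatesPrg sel) s' s t) ?_
    (runs_gatesPrg_setSym (v := { v with sym := none }) v.sym h)
  cases m; cases v
  simp_all [Mem.get, Mem.set, Reg.setSym, Reg.setBit, Reg.bitD, Reg.symD]

theorem runs_gatesPrg_replicate_tally {g : List CircuitSymbol} {w w' : List Bool}
    (hg : m.gate = List.replicate w.length .tally ++ g) (hw : m.wire = w ++ w')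
    (hb : v.bit = none)
    (h : Runs (gatesPrg sel) ⟨v,
      { m with gate := g, gateAux := List.replicate w.length .tally ++ m.gateAux, wire := w',
               wireAux := w.reverse ++ m.wireAux }⟩ s t) :
    Runs (gatesPrg sel) ⟨v, m⟩ s (t + w.length) := by
  induction w generalizing m with
  | nil =>
    refine Runs.mono (Eq.subst (motive := fun s' => Runs (gatesPrg sel) s' s t) ?_ h) (by simp)
    cases m
    simp_all
  | cons b w ih =>
    refine runs_gatesPrg_tally hg hw hb (ih rfl rfl ?_)
    simpa [List.replicate_succ', List.append_assoc] using h

/-- The register after a gate has used its argument `b` and the variable `y`. -/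
def Reg.useArg (v : Reg) (b y : Bool) : Reg :=
  { v with
    ph := if v.rem = 0 then xor v.ph (v.acc && b && (!v.isH || y)) else v.ph
    acc := if v.rem = 0 then false else v.acc && b && (!v.isH || y)
    isH := false
    rem := if v.rem = 0 then 0 else v.rem - 1 }

theorem runs_gatesPrg_sep {g : List CircuitSymbol} {b : Bool} {w : List Bool}
    (hg : m.gate = .sep :: g) (hw : m.wire = b :: w) (hb : v.bit = none) (hH : v.isH = false)
    (h : Runs (gatesPrg sel) ⟨v.useArg b false,
      { m with gate := g, gateAux := .sep :: m.gateAux, wire := m.wireAux.reverse ++ b :: w,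
               wireAux := [] }⟩ s t) :
    Runs (gatesPrg sel) ⟨v, m⟩ s (t + m.wireAux.length + 2) := by
  refine (runs_forEach_cons (k := .gate) hg rfl
    ((Runs.iteFalse rfl (Runs.iteTrue rfl
      ((Runs.straight rfl rfl).seq (runs_rewindWire _ _)))).seq (Runs.straight rfl rfl))
    (runs_gatesPrg_setSym (sel := sel) none (t := t) (s := s) ?_)).mono ?_
  · refine Eq.subst (motive := fun s' => Runs (gatesPrg sel) s' s t) ?_
      (runs_gatesPrg_setSym (v := { v.useArg b false with sym := none }) v.sym h)
    cases m; cases v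
    simp_all [Cmd.eval, Mem.get, Mem.set, Reg.setSym, Reg.setBit, Reg.bitD, Reg.symD, Reg.useArg]
  · cases m; cases v
    simp_all [Cmd.eval, Mem.get, Mem.set, Reg.setSym, Reg.setBit, Reg.bitD]
    omega

/-- At the argument of a Hadamard gate the old wire value enters the phase together with the next
variable, which then replaces it. On an exhausted tape that variable reads as zero; this is what
fixes the outputs of the last column. -/
theorem runs_gatesPrg_sep_of_isH {g : List CircuitSymbol} {b : Bool} {w : List Bool}
    (hg : m.gate = .sep :: g) (hw : m.wire = b :: w) (hb : v.bit = none) (hc : v.cell = none)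
    (hH : v.isH = true)
    (h : Runs (gatesPrg sel) ⟨v.useArg b (bitSeq (m.tape.map sel) 0),
      { m with gate := g, gateAux := .sep :: m.gateAux, tape := m.tape.tail,
               tapeAux := m.tape.head?.toList ++ m.tapeAux
               wire := m.wireAux.reverse ++ bitSeq (m.tape.map sel) 0 :: w, wireAux := [] }⟩ s t) :
    Runs (gatesPrg sel) ⟨v, m⟩ s (t + m.wireAux.length + 2) := by
  refine (runs_forEach_cons (k := .gate) hg rfl
    ((Runs.iteFalse rfl (Runs.iteTrue rfl
      ((Runs.straight rfl rfl).seq (runs_rewindWire _ _)))).seq (Runs.straight rfl rfl))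
    (runs_gatesPrg_setSym (sel := sel) none (t := t) (s := s) ?_)).mono ?_
  · refine Eq.subst (motive := fun s' => Runs (gatesPrg sel) s' s t) ?_
      (runs_gatesPrg_setSym
        (v := { v.useArg b (bitSeq (m.tape.map sel) 0) with sym := none }) v.sym h)
    obtain ⟨_, _, _, _, tape, _⟩ := m; cases v
    cases tape <;>
    simp_all [Cmd.eval, Mem.get, Mem.set, Reg.setSym, Reg.setBit, Reg.bitD, Reg.symD, Reg.useArg,
      Reg.setCell, Reg.cellD, hadamardPrg, bitSeq]
  · obtain ⟨_, _, _, _, tape, _⟩ := m; cases v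
    cases tape <;>
    simp_all [Cmd.eval, Mem.get, Mem.set, Reg.setSym, Reg.setBit, Reg.bitD, Reg.setCell,
      Reg.cellD, hadamardPrg] <;> omega

theorem runs_gatesPrg_tag {g : List CircuitSymbol} {a : CircuitSymbol} (hg : m.gate = a :: g)
    (ha : a.isTally = false) (ha' : a.isSep = false)
    (h : Runs (gatesPrg sel) ⟨{ v with acc := true, isH := a.isTagH, rem := a.furtherArgs },
      { m with gate := g, gateAux := a :: m.gateAux }⟩ s t) :
    Runs (gatesPrg sel) ⟨v, m⟩ s (t + 1) := by
  refine (runs_forEach_cons (k := .gate) hg rfl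
    ((Runs.iteFalse ha (Runs.iteFalse ha' (Runs.straight rfl rfl))).seq (Runs.straight rfl rfl))
    (runs_gatesPrg_setSym (sel := sel) none (t := t) (s := s) ?_)).mono (by omega)
  exact runs_gatesPrg_setSym (v := { v with sym := none, acc := true, isH := _, rem := _ }) v.sym h

end

section

variable {sel : TapeCell → Bool} {v : Reg} {m : Mem} {s : Conf} {t ℓ : ℕ}

theorem listOfFn_eq_take_append {α : Type} (c : Fin ℓ → α) (i : Fin ℓ) :
    List.ofFn c = (List.ofFn c).take i ++ c i :: (List.ofFn c).drop (i + 1) := by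
  conv_lhs => rw [← List.take_append_drop i (List.ofFn c)]
  rw [List.drop_eq_getElem_cons (by simp)]
  simp

theorem listOfFn_update {α : Type} (c : Fin ℓ → α) (i : Fin ℓ) (a : α) :
    List.ofFn (Function.update c i a) =
      (List.ofFn c).take i ++ a :: (List.ofFn c).drop (i + 1) := by
  rw [listOfFn_eq_take_append _ i, Function.update_self]
  congr 1
  · refine List.ext_getElem (by simp) fun j h₁ h₂ => ?_
    have : j < i := by simp at h₁; omega
    simp [Function.update_of_ne, Fin.ext_iff, this.ne]
  · congr 1
    refine List.ext_getElem (by simp) fun j h₁ h₂ => ?_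
    simp only [List.getElem_drop, List.getElem_ofFn]
    rw [Function.update_of_ne]
    simp only [ne_eq, Fin.ext_iff]
    omega

theorem encodeUnary_eq (i : ℕ) :
    encodeUnary i = List.replicate i .tally ++ [CircuitSymbol.sep] := rfl

theorem runs_gatesPrg_arg {g : List CircuitSymbol} {c : Fin ℓ → Bool} (i : Fin ℓ)
    (hg : m.gate = encodeUnary i ++ g) (hw : m.wire = List.ofFn c) (hw' : m.wireAux = [])
    (hb : v.bit = none) (hH : v.isH = false)
    (h : Runs (gatesPrg sel) ⟨v.useArg (c i) false,
      { m with gate := g, gateAux := (encodeUnary i).reverse ++ m.gateAux }⟩ s t) :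
    Runs (gatesPrg sel) ⟨v, m⟩ s (t + 2 * (encodeUnary i).length) := by
  have hl : ((List.ofFn c).take i).length = i := by simp
  refine (runs_gatesPrg_replicate_tally (w := (List.ofFn c).take i)
    (w' := c i :: (List.ofFn c).drop (i + 1)) (g := .sep :: g) ?_ ?_ hb
    (runs_gatesPrg_sep rfl rfl hb hH
      (Eq.subst (motive := fun s' => Runs (gatesPrg sel) s' s t) ?_ h))).mono ?_
  · rw [hg, hl, encodeUnary_eq, List.append_assoc]; rfl
  · rw [hw]; exact listOfFn_eq_take_append c i
  · obtain ⟨⟩ := m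
    simp_all [encodeUnary_eq, ← listOfFn_eq_take_append]
  · simp [hw', encodeUnary_eq]; omega

theorem runs_gatesPrg_arg_of_isH {g : List CircuitSymbol} {c : Fin ℓ → Bool} (i : Fin ℓ)
    (hg : m.gate = encodeUnary i ++ g) (hw : m.wire = List.ofFn c) (hw' : m.wireAux = [])
    (hb : v.bit = none) (hc : v.cell = none) (hH : v.isH = true)
    (h : Runs (gatesPrg sel) ⟨v.useArg (c i) (bitSeq (m.tape.map sel) 0),
      { m with gate := g, gateAux := (encodeUnary i).reverse ++ m.gateAux, tape := m.tape.tail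
               tapeAux := m.tape.head?.toList ++ m.tapeAux
               wire := List.ofFn (Function.update c i (bitSeq (m.tape.map sel) 0)) }⟩ s t) :
    Runs (gatesPrg sel) ⟨v, m⟩ s (t + 2 * (encodeUnary i).length) := by
  have hl : ((List.ofFn c).take i).length = i := by simp
  refine (runs_gatesPrg_replicate_tally (w := (List.ofFn c).take i)
    (w' := c i :: (List.ofFn c).drop (i + 1)) (g := .sep :: g) ?_ ?_ hb
    (runs_gatesPrg_sep_of_isH rfl rfl hb hc hH
      (Eq.subst (motive := fun s' => Runs (gatesPrg sel) s' s t) ?_ h))).mono ?_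
  · rw [hg, hl, encodeUnary_eq, List.append_assoc]; rfl
  · rw [hw]; exact listOfFn_eq_take_append c i
  · obtain ⟨⟩ := m
    simp_all [encodeUnary_eq, listOfFn_update]
  · simp [hw', encodeUnary_eq]; omega

/-- Registers between two gates. -/
structure Reg.Idle (v : Reg) : Prop where
  bit : v.bit = none
  cell : v.cell = none
  acc : v.acc = false
  isH : v.isH = false
  rem : v.rem = 0

theorem bitSeq_map_tail (l : List TapeCell) :
    bitSeq (l.tail.map sel) = fun j => bitSeq (l.map sel) (j + 1) := by
  funext j
  cases l <;> simp [bitSeq]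

/-- Only two facts about the new tape position matter later: both halves together still form the
same tape, and the unread half spells the remaining variables. Two tests per symbol suffice, since a
wire that is passed over is moved once forward and once back. -/
theorem runs_gatesPrg_gate {g : List CircuitSymbol} {c : Fin ℓ → Bool} (a : QGate ℓ)
    (hg : m.gate = a.encode ++ g) (hw : m.wire = List.ofFn c) (hw' : m.wireAux = [])
    (hv : v.Idle) :
    ∃ tp tpAux, tpAux.reverse ++ tp = m.tapeAux.reverse ++ m.tape ∧
      bitSeq (tp.map sel) = a.rest (bitSeq (m.tape.map sel)) ∧
      ∀ s t, Runs (gatesPrg sel)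
        ⟨{ v with ph := xor v.ph (a.phase c (bitSeq (m.tape.map sel))) },
          { m with gate := g, gateAux := a.encode.reverse ++ m.gateAux, tape := tp
                   tapeAux := tpAux
                   wire := List.ofFn (a.wires c (bitSeq (m.tape.map sel))) }⟩ s t →
        Runs (gatesPrg sel) ⟨v, m⟩ s (t + 2 * a.encode.length) := by
  obtain ⟨h₁, h₂, h₃, h₄, h₅⟩ := hv
  cases a with
  | H i =>
    refine ⟨m.tape.tail, m.tape.head?.toList ++ m.tapeAux, ?_, bitSeq_map_tail _, fun s t h => ?_⟩
    · cases m.tape <;> simp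
    refine (runs_gatesPrg_tag hg rfl rfl (runs_gatesPrg_arg_of_isH i rfl hw hw' h₁ h₂ rfl
      (Eq.subst (motive := fun s' => Runs (gatesPrg sel) s' s t) ?_ h))).mono ?_
    · cases v; cases m
      simp_all [Reg.useArg, QGate.phase, QGate.wires, QGate.encode, CircuitSymbol.isTagH,
        CircuitSymbol.furtherArgs]
    · simp [QGate.encode]
  | Z i =>
    refine ⟨m.tape, m.tapeAux, rfl, rfl, fun s t h => ?_⟩
    refine (runs_gatesPrg_tag hg rfl rfl (runs_gatesPrg_arg i rfl hw hw' h₁ rfl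
      (Eq.subst (motive := fun s' => Runs (gatesPrg sel) s' s t) ?_ h))).mono ?_
    · cases v; cases m
      simp_all [Reg.useArg, QGate.phase, QGate.wires, QGate.encode, CircuitSymbol.isTagH,
        CircuitSymbol.furtherArgs]
    · simp [QGate.encode]
  | CZ i j hij =>
    refine ⟨m.tape, m.tapeAux, rfl, rfl, fun s t h => ?_⟩
    refine (runs_gatesPrg_tag hg rfl rfl (runs_gatesPrg_arg i (List.append_assoc _ _ _) hw hw' h₁
      rfl (runs_gatesPrg_arg j rfl hw hw' h₁ rfl
      (Eq.subst (motive := fun s' => Runs (gatesPrg sel) s' s t) ?_ h)))).mono ?_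
    · cases v; cases m
      simp_all [Reg.useArg, QGate.phase, QGate.wires, QGate.encode, CircuitSymbol.isTagH,
        CircuitSymbol.furtherArgs]
    · simp [QGate.encode]; omega
  | CCZ i j k hij hik hjk =>
    refine ⟨m.tape, m.tapeAux, rfl, rfl, fun s t h => ?_⟩
    refine (runs_gatesPrg_tag (a := .tagCCZ)
      (g := encodeUnary i ++ (encodeUnary j ++ (encodeUnary k ++ g)))
      (hg.trans (by simp [QGate.encode])) rfl rfl (runs_gatesPrg_arg i rfl hw hw' h₁
      rfl (runs_gatesPrg_arg j rfl hw hw' h₁ rfl (runs_gatesPrg_arg k rfl hw hw' h₁ rfl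
      (Eq.subst (motive := fun s' => Runs (gatesPrg sel) s' s t) ?_ h))))).mono ?_
    · cases v; cases m
      simp_all [Reg.useArg, QGate.phase, QGate.wires, QGate.encode, CircuitSymbol.isTagH,
        CircuitSymbol.furtherArgs]
    · simp [QGate.encode]; omega

theorem runs_gatesPrg (gs : List (QGate ℓ)) (c : Fin ℓ → Bool)
    (hg : m.gate = gs.flatMap QGate.encode) (hw : m.wire = List.ofFn c) (hw' : m.wireAux = [])
    (hv : v.Idle) :
    ∃ tp tpAux w, tpAux.reverse ++ tp = m.tapeAux.reverse ++ m.tape ∧ w.length = ℓ ∧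
      Runs (gatesPrg sel) ⟨v, m⟩
        ⟨{ v with sym := none, ph := xor v.ph (pathPhase gs c (bitSeq (m.tape.map sel))) },
          { m with gate := [], gateAux := m.gate.reverse ++ m.gateAux, tape := tp,
                   tapeAux := tpAux, wire := w }⟩ (2 * m.gate.length + 1) := by
  induction gs generalizing c v m with
  | nil =>
    refine ⟨m.tape, m.tapeAux, m.wire, rfl, by simp [hw],
      (runs_forEach_nil (k := .gate) hg rfl).of ?_ (by omega)⟩
    cases m
    simp_all [Reg.setSym, pathPhase]
  | cons a gs ih =>
    rw [List.flatMap_cons] at hg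
    obtain ⟨tp, tpAux, h₁, h₂, h⟩ := runs_gatesPrg_gate (sel := sel) a hg hw hw' hv
    obtain ⟨tp', tpAux', w, h₃, h₄, h₅⟩ := ih
      (m := { m with gate := gs.flatMap QGate.encode, gateAux := a.encode.reverse ++ m.gateAux
                     tape := tp, tapeAux := tpAux
                     wire := List.ofFn (a.wires c (bitSeq (m.tape.map sel))) })
      (v := { v with ph := xor v.ph (a.phase c (bitSeq (m.tape.map sel))) })
      (a.wires c (bitSeq (m.tape.map sel))) rfl rfl hw' ⟨hv.1, hv.2, hv.3, hv.4, hv.5⟩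
    refine ⟨tp', tpAux', w, h₃.trans h₁, h₄, (h _ _ h₅).of ?_ ?_⟩
    · simp [h₂, hg, pathPhase]
    · simp [hg]; omega

/-- Everything except `ph` is restored, so evaluations can be repeated and their phases accumulate
by exclusive or. The bound adds interpretation, rewinding of gates and tape, and clearing of the
wires. -/
theorem runs_phasePrg {l : List TapeCell} (gs : List (QGate ℓ))
    (hg : m.gate = gs.flatMap QGate.encode) (hg' : m.gateAux = [])
    (ht : m.tape = l) (ht' : m.tapeAux = []) (hw : m.wire = List.replicate ℓ false)
    (hw' : m.wireAux = []) (hv : v.Idle) (hs : v.sym = none) :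
    Runs (phasePrg sel) ⟨v, m⟩
      ⟨{ v with ph := xor v.ph (pathPhase gs (fun _ => false) (bitSeq (l.map sel))) }, m⟩
      (3 * m.gate.length + l.length + 2 * ℓ + 5) := by
  obtain ⟨tp, tpAux, w, h₁, h₂, h₃⟩ := runs_gatesPrg (sel := sel) gs (fun _ => false) hg
    (by simp [hw]) hw' hv
  have hl : tpAux.length ≤ l.length := by
    have := congrArg List.length h₁
    simp [ht, ht'] at this
    omega
  refine (h₃.seq ((runs_rewindGate _ _).seq ((runs_rewindTape _ _).seq
    (runs_clearWire _ _ hw')))).of ?_ ?_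
  · obtain ⟨h₁, h₂, h₃, h₄, h₅⟩ := hv
    cases v; cases m
    simp_all
  · simp [hg', h₂]
    omega

end

/-! ### A binary counter on the selected coordinates -/

/-- The number of selected coordinates. -/
def numSelected {n : ℕ} (B : Fin n → Bool) : ℕ := ∑ j, (B j).toNat

/-- The binary digits of `t`, written on the selected coordinates. -/
def counterBits : {n : ℕ} → (Fin n → Bool) → ℕ → Fin n → Bool
  | 0, _, _ => fun _ => false
  | _ + 1, B, t =>
      Fin.cons (B 0 && decide (t % 2 = 1)) (counterBits (Fin.tail B) (if B 0 then t / 2 else t))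

section

variable {n : ℕ}

theorem numSelected_succ (B : Fin (n + 1) → Bool) :
    numSelected B = (B 0).toNat + numSelected (Fin.tail B) := Fin.sum_univ_succ _

theorem counterBits_zero (B : Fin n → Bool) : counterBits B 0 = fun _ => false := by
  induction n with
  | zero => rfl
  | succ n ih =>
    funext j
    cases j using Fin.cases <;> simp [counterBits, ih]

/-- On overflow the counter returns to zero, so a full enumeration leaves the tape as it was. -/
theorem counterBits_two_pow (B : Fin n → Bool) :
    counterBits B (2 ^ numSelected B) = fun _ => false := by
  induction n with
  | zero => rfl
  | succ n ih =>
    funext j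
    rw [counterBits, numSelected_succ]
    cases B 0 <;> cases j using Fin.cases <;> simp [ih, pow_add]

theorem le_of_counterBits (B : Fin n → Bool) (t : ℕ) (j : Fin n) (h : counterBits B t j = true) :
    B j = true := by
  induction n generalizing t with
  | zero => exact j.elim0
  | succ n ih =>
    cases j using Fin.cases with
    | zero => simp [counterBits] at h; exact h.1
    | succ j => exact ih _ _ _ (by simpa [counterBits] using h)

theorem counterBits_injOn (B : Fin n → Bool) {t t' : ℕ} (ht : t < 2 ^ numSelected B)
    (ht' : t' < 2 ^ numSelected B) (h : counterBits B t = counterBits B t') : t = t' := by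
  induction n generalizing t t' with
  | zero => simp [numSelected] at ht ht'; omega
  | succ n ih =>
    rw [numSelected_succ] at ht ht'
    rw [counterBits, counterBits, Fin.cons_inj] at h
    cases hB : B 0
    · simp [hB] at h ht ht'
      exact ih _ ht ht' h
    · simp [hB, pow_add] at h ht ht'
      have := ih _ (t := t / 2) (t' := t' / 2) (by omega) (by omega) h.2
      omega

/-- With `le_of_counterBits` and `counterBits_injOn`, this makes the counter a bijection from the
numbers below `2 ^ numSelected B` to the vectors supported on `B`. -/
theorem exists_counterBits (B x : Fin n → Bool) (h : ∀ j, x j = true → B j = true) :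
    ∃ t < 2 ^ numSelected B, counterBits B t = x := by
  induction n with
  | zero => exact ⟨0, by simp, Subsingleton.elim _ _⟩
  | succ n ih =>
    obtain ⟨t, ht, e⟩ := ih (Fin.tail B) (Fin.tail x) fun j => h j.succ
    cases hB : B 0
    · refine ⟨t, by simpa [numSelected_succ, hB] using ht, ?_⟩
      have : x 0 = false := by
        by_contra hx
        simp [h 0 (by simpa using hx)] at hB
      rw [counterBits, hB, ← Fin.cons_self_tail x]
      simp [e, this]
    · refine ⟨2 * t + (x 0).toNat, ?_, ?_⟩
      · have := Bool.toNat_lt (x 0)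
        simp only [numSelected_succ, hB, pow_add, Bool.toNat_true]
        omega
      · have h₁ : (2 * t + (x 0).toNat) / 2 = t := by have := Bool.toNat_lt (x 0); omega
        rw [counterBits, hB, ← Fin.cons_self_tail x]
        simp only [Fin.cons_zero, h₁, if_true, e, Bool.true_and]
        cases x 0 <;> simp

variable {α : Type}

/-- A pass that exchanges the state with one track of each cell shifts that track by one place. The
state before the pass enters at the front, and the last entry becomes the new state. -/
theorem passState_ofFn_shift (f : Bool → α → Bool × α) (mk : Fin n → Bool → α)
    (hf : ∀ j b c, f c (mk j b) = (b, mk j c)) (h : ℕ → Bool) :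
    List.passState f (h 0) (List.ofFn fun j => mk j (h (j + 1))) =
      (h n, List.ofFn fun j => mk j (h j)) := by
  induction n generalizing h with
  | zero => rfl
  | succ n ih =>
    have := ih (fun j => mk j.succ) (fun j => hf j.succ) (fun j => h (j + 1))
    simp only [List.ofFn_succ, List.passState, hf, Fin.val_zero, Fin.val_succ, this]

theorem passState_ofFn_map (f : Bool → α → Bool × α) (g : α → α) (hf : ∀ c a, f c a = (c, g a))
    (c : Bool) (l : List α) : l.passState f c = (c, l.map g) := by
  induction l with
  | nil => rfl
  | cons a l ih => simp [List.passState, hf, ih]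

theorem passState_ofFn_increment (f : Bool → α → Bool × α) (mk : Fin n → Bool → α)
    (B : Fin n → Bool)
    (hf : ∀ j b c, f c (mk j b) = if B j then (c && b, mk j (xor b c)) else (c, mk j b))
    {t : ℕ} (ht : t < 2 ^ numSelected B) :
    List.passState f true (List.ofFn fun j => mk j (counterBits B t j)) =
      (decide (t + 1 = 2 ^ numSelected B), List.ofFn fun j => mk j (counterBits B (t + 1) j)) := by
  -- Once the carry is cleared, the rest of the tape does not change.
  have hfalse : ∀ {n : ℕ} (mk : Fin n → Bool → α) (B : Fin n → Bool) (x : Fin n → Bool),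
      (∀ j b c, f c (mk j b) = if B j then (c && b, mk j (xor b c)) else (c, mk j b)) →
      List.passState f false (List.ofFn fun j => mk j (x j)) =
        (false, List.ofFn fun j => mk j (x j)) := by
    intro n mk B x hf
    induction n with
    | zero => rfl
    | succ n ih =>
      have := ih (fun j => mk j.succ) (Fin.tail B) (Fin.tail x) (fun j => hf j.succ)
      have h0 : f false (mk 0 (x 0)) = (false, mk 0 (x 0)) := by rw [hf]; simp
      simp only [List.ofFn_succ, List.passState, h0]
      simp only [Fin.tail] at this
      rw [this]
  induction n generalizing t with
  | zero => simp [numSelected] at ht ⊢; simp [ht, List.passState]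
  | succ n ih =>
    rw [numSelected_succ] at ht
    have ih := fun t => ih (t := t) (fun j => mk j.succ) (Fin.tail B) (fun j => hf j.succ)
    have h0 := hfalse (fun j => mk j.succ) (Fin.tail B) (counterBits (Fin.tail B) (t / 2))
      (fun j => hf j.succ)
    rw [numSelected_succ]
    cases hB : B 0
    · simp [hB] at ht
      simp [List.ofFn_succ, List.passState, hf, counterBits, hB, ih t ht]
    · simp [hB, pow_add] at ht
      rcases Nat.mod_two_eq_zero_or_one t with h | h
      · have e₁ : (t + 1) / 2 = t / 2 := by omega
        have e₂ : (t + 1) % 2 = 1 := by omega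
        have e₃ : t + 1 ≠ 2 * 2 ^ numSelected (Fin.tail B) := by omega
        simp [List.ofFn_succ, List.passState, hf, counterBits, hB, h, e₁, e₂, e₃, h0, pow_add]
      · have e₁ : (t + 1) / 2 = t / 2 + 1 := by omega
        have e₂ : (t + 1) % 2 = 0 := by omega
        have e₃ : t + 1 = 2 * 2 ^ numSelected (Fin.tail B) ↔
          t / 2 + 1 = 2 ^ numSelected (Fin.tail B) := by omega
        simp [List.ofFn_succ, List.passState, hf, counterBits, hB, h, e₁, e₂, e₃,
          ih (t / 2) (by omega), pow_add]

end

/-! ### Period test, greedy selection and counting: specifications and programs -/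

/-- The phase of the path with the variables `y` that starts in the zero state. -/
def pathFun {ℓ n : ℕ} (gs : List (QGate ℓ)) (y : Fin n → Bool) : Bool :=
  pathPhase gs (fun _ => false) (bitSeq (List.ofFn y))

/-- The unit vector at `p - 1`, and zero for `p = 0`. -/
def pointerVec (n p : ℕ) (j : Fin n) : Bool := decide (p = j + 1)

/-- Does the shift by `w` not change the values of `f` at the vectors of weight at most two? -/
def quadTest {n : ℕ} (f : (Fin n → Bool) → Bool) (w : Fin n → Bool) : Bool :=
  decide (∀ p < n + 1, ∀ q < n + 1, f (w + (pointerVec n p + pointerVec n q)) =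
    f (pointerVec n p + pointerVec n q))

/-- Does some vector on the coordinates selected by `B`, or its sum with the vector at `i`,
pass the test? -/
def searchTest {n : ℕ} (f : (Fin n → Bool) → Bool) (B : Fin n → Bool) (i : ℕ) : Bool :=
  decide (∃ t < 2 ^ numSelected B, quadTest f (counterBits B t + pointerVec n i) = true)

/-- The coordinates selected by the greedy algorithm among the first `k`. -/
def greedy {n : ℕ} (f : (Fin n → Bool) → Bool) : ℕ → Fin n → Bool
  | 0 => fun _ => false
  | k + 1 => if searchTest f (greedy f k) (k + 1) then greedy f k
      else fun j => greedy f k j || pointerVec n (k + 1) j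

/-- The state of the main computation, with `n` variables. -/
structure Work (n : ℕ) : Type where
  x : Fin n → Bool := fun _ => false
  b : Fin n → Bool := fun _ => false
  i : ℕ := 0
  p : ℕ := 0
  q : ℕ := 0
  ok : Bool := false
  found : Bool := false
  carry : Bool := false
  n₀ : ℕ := 0
  n₁ : ℕ := 0

namespace Work

variable {ℓ n : ℕ}

/-- The contents of a cell of the tape. -/
def cell (w : Work n) (j : Fin n) : TapeCell :=
  ⟨w.x j, w.b j, pointerVec n w.i j, pointerVec n w.p j, pointerVec n w.q j⟩

/-- The configuration that represents a state of the main computation. -/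
def conf (gs : List (QGate ℓ)) (w : Work n) : Conf where
  reg := { ok := w.ok, found := w.found, carry := w.carry, pi := decide (w.i = 0),
           pp := decide (w.p = 0), pq := decide (w.q = 0) }
  mem := { gate := gs.flatMap QGate.encode, wire := List.replicate ℓ false
           tape := List.ofFn w.cell, una := List.replicate w.n₀ true
           unaAux := List.replicate w.n₁ true }

end Work

/-- The next position of a pointer. -/
def nextPointer (n p : ℕ) : ℕ := if p = n then 0 else p + 1

/-- Move the pointer to the candidate. -/
def rotI : Prg :=
  .load (fun v => { v with carry := v.pi }) ;; tapePass (fun c a => (a.i, { a with i := c })) ;;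
    .load fun v => { v with pi := v.carry, carry := false }

/-- Move the first pointer. -/
def rotP : Prg :=
  .load (fun v => { v with carry := v.pp }) ;; tapePass (fun c a => (a.p, { a with p := c })) ;;
    .load fun v => { v with pp := v.carry, carry := false }

/-- Move the second pointer. -/
def rotQ : Prg :=
  .load (fun v => { v with carry := v.pq }) ;; tapePass (fun c a => (a.q, { a with q := c })) ;;
    .load fun v => { v with pq := v.carry, carry := false }

/-- Go to the next assignment on the selected coordinates. -/
def incrementPrg : Prg :=
  .load (fun v => { v with carry := true }) ;;
    tapePass (fun c a => if a.b then (c && a.x, { a with x := xor a.x c }) else (c, a))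

/-- Select the candidate. -/
def selectPrg : Prg := tapePass fun c a => (c, { a with b := a.b || a.i })

/-- Compare the values of the phase at two vectors. -/
def comparePrg : Prg :=
  phasePrg (fun a => xor (xor a.x a.i) (xor a.p a.q)) ;; phasePrg (fun a => xor a.p a.q) ;;
    .load fun v => { v with ok := v.ok && !v.ph, ph := false }

/-- Compare the values of the phase at all vectors of weight at most two. -/
def quadTestPrg : Prg :=
  repeatUntil Reg.pp (repeatUntil Reg.pq (comparePrg ;; rotQ) ;; rotP)

/-- Look for an assignment that passes the test. -/
def searchPrg : Prg :=
  repeatUntil Reg.carry (.load (fun v => { v with ok := true }) ;; quadTestPrg ;;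
    .load (fun v => { v with found := v.found || v.ok, ok := false }) ;; incrementPrg) ;;
  .load fun v => { v with carry := false }

/-- Select coordinates greedily. -/
def greedyPrg : Prg :=
  repeatUntil Reg.pi (rotI ;; .ite Reg.pi .skip
    (searchPrg ;; .ite Reg.found .skip selectPrg ;; .load fun v => { v with found := false }))

/-- Count the assignments by their phase. -/
def countPrg : Prg :=
  repeatUntil Reg.carry (phasePrg TapeCell.x ;;
    .ite Reg.ph (.push .unaAux fun _ => true) (.push .una fun _ => true) ;;
    .load (fun v => { v with ph := false }) ;; incrementPrg) ;;
  .load fun v => { v with carry := false }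

/-! ### Correctness and running time of the main loops -/

section

variable {ℓ n : ℕ} {gs : List (QGate ℓ)} {w : Work n}

theorem pointerVec_eq_zero {p : ℕ} (hp : p = n + 1 ∨ p = 0) : pointerVec n p = fun _ => false := by
  funext j
  have := j.2
  simp [pointerVec]
  omega

/-- A pointer moves cyclically through `n + 1` positions. Position 0 lies off the tape and is kept
as a bit of the register; it stands for the zero vector. -/
theorem passState_pointer (f : Bool → TapeCell → Bool × TapeCell) (mk : Fin n → Bool → TapeCell)
    (hf : ∀ j b c, f c (mk j b) = (b, mk j c)) (p : ℕ) :
    List.passState f (decide (p = 0)) (List.ofFn fun j => mk j (pointerVec n p j)) =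
      (decide (nextPointer n p = 0),
        List.ofFn fun j => mk j (pointerVec n (nextPointer n p) j)) := by
  -- In the extended track, entry 0 is the bit of the register and entry `j + 1` belongs to cell
  -- `j`.
  refine (passState_ofFn_shift f mk hf fun j => decide (p = j)).trans (Prod.ext ?_ ?_)
  · simp [nextPointer]
  · refine congrArg List.ofFn (funext fun j => congrArg (mk j) ?_)
    have := j.2
    rw [Bool.eq_iff_iff]
    by_cases h : p = n
    · simp [pointerVec, nextPointer, h]; omega
    · simp [pointerVec, nextPointer, h]

theorem runs_tapePass_of_eq {f : Bool → TapeCell → Bool × TapeCell} (v : Reg) (m : Mem)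
    {b : Bool} {l : List TapeCell} (hm : m.tapeAux = [])
    (h : List.passState f v.carry m.tape = (b, l)) :
    Runs (tapePass f) ⟨v, m⟩ ⟨{ v with cell := none, carry := b }, { m with tape := l }⟩
      (2 * m.tape.length + 2) := by
  refine (runs_tapePass f v m hm).of ?_ le_rfl
  rw [h]

theorem runs_rotI :
    Runs rotI (w.conf gs) ({ w with i := nextPointer n w.i, carry := false }.conf gs)
      (2 * n + 2) := by
  have h := passState_pointer (fun c a => (a.i, { a with i := c }))
    (fun j b => { w.cell j with i := b }) (fun _ _ _ => rfl) w.i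
  exact ((Runs.straight rfl rfl).seq ((runs_tapePass_of_eq
    { (w.conf gs).reg with carry := decide (w.i = 0) } (w.conf gs).mem rfl h).seq
    (Runs.straight rfl rfl))).of rfl (by simp [Work.conf])

theorem runs_rotP :
    Runs rotP (w.conf gs) ({ w with p := nextPointer n w.p, carry := false }.conf gs)
      (2 * n + 2) := by
  have h := passState_pointer (fun c a => (a.p, { a with p := c }))
    (fun j b => { w.cell j with p := b }) (fun _ _ _ => rfl) w.p
  exact ((Runs.straight rfl rfl).seq ((runs_tapePass_of_eq
    { (w.conf gs).reg with carry := decide (w.p = 0) } (w.conf gs).mem rfl h).seq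
    (Runs.straight rfl rfl))).of rfl (by simp [Work.conf])

theorem runs_rotQ :
    Runs rotQ (w.conf gs) ({ w with q := nextPointer n w.q, carry := false }.conf gs)
      (2 * n + 2) := by
  have h := passState_pointer (fun c a => (a.q, { a with q := c }))
    (fun j b => { w.cell j with q := b }) (fun _ _ _ => rfl) w.q
  exact ((Runs.straight rfl rfl).seq ((runs_tapePass_of_eq
    { (w.conf gs).reg with carry := decide (w.q = 0) } (w.conf gs).mem rfl h).seq
    (Runs.straight rfl rfl))).of rfl (by simp [Work.conf])

theorem runs_incrementPrg {t : ℕ} (ht : t < 2 ^ numSelected w.b) (hx : w.x = counterBits w.b t) :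
    Runs incrementPrg (w.conf gs) ({ w with
      x := counterBits w.b (t + 1), carry := decide (t + 1 = 2 ^ numSelected w.b) }.conf gs)
      (2 * n + 2) := by
  have h := passState_ofFn_increment
    (fun c a => if a.b then (c && a.x, { a with x := xor a.x c }) else (c, a))
    (fun j b => { w.cell j with x := b }) w.b (fun _ _ _ => rfl) ht
  rw [← hx] at h
  exact ((Runs.straight rfl rfl).seq (runs_tapePass_of_eq
    { (w.conf gs).reg with carry := true } (w.conf gs).mem rfl h)).of rfl (by simp [Work.conf])

theorem runs_selectPrg :
    Runs selectPrg (w.conf gs)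
      ({ w with b := fun j => w.b j || pointerVec n w.i j }.conf gs) (2 * n + 2) := by
  have h := passState_ofFn_map (fun c a => (c, { a with b := a.b || a.i })) _ (fun _ _ => rfl)
    w.carry (List.ofFn w.cell)
  rw [List.map_ofFn] at h
  exact (runs_tapePass_of_eq (w.conf gs).reg (w.conf gs).mem rfl h).of rfl (by simp [Work.conf])

/-- A bound for the time in which the phase of a path is computed. -/
def phaseTime {ℓ : ℕ} (n : ℕ) (gs : List (QGate ℓ)) : ℕ :=
  3 * (gs.flatMap QGate.encode).length + n + 2 * ℓ + 5

theorem runs_phasePrg_conf (sel : TapeCell → Bool) (v : Reg) (hv : v.Idle) (hs : v.sym = none) :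
    Runs (phasePrg sel) ⟨v, (w.conf gs).mem⟩
      ⟨{ v with ph := xor v.ph (pathFun gs fun j => sel (w.cell j)) }, (w.conf gs).mem⟩
      (phaseTime n gs) := by
  refine (runs_phasePrg gs rfl rfl rfl rfl rfl rfl hv hs).of ?_ (by simp [phaseTime, Work.conf])
  rw [pathFun, show List.ofFn (fun j => sel (w.cell j)) = (w.conf gs).mem.tape.map sel from
    List.map_ofFn.symm]

/-- Each vector is read off the tape as an exclusive or of tracks. The second phase is added to the
first one in `ph`, which is therefore zero exactly when the two agree. -/
theorem runs_comparePrg :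
    Runs comparePrg (w.conf gs) ({ w with
      ok := w.ok && decide (
        pathFun gs (w.x + pointerVec n w.i + (pointerVec n w.p + pointerVec n w.q)) =
          pathFun gs (pointerVec n w.p + pointerVec n w.q)) }.conf gs)
      (2 * phaseTime n gs) := by
  refine ((runs_phasePrg_conf _ (w.conf gs).reg ⟨rfl, rfl, rfl, rfl, rfl⟩ rfl).seq
    ((runs_phasePrg_conf _ _ ⟨rfl, rfl, rfl, rfl, rfl⟩ rfl).seq
    (Runs.straight rfl rfl))).of ?_ (by omega)
  simp only [Cmd.eval, Work.conf, Work.cell]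
  congr 2
  change (w.ok && !(xor (xor false (pathFun gs
    (w.x + pointerVec n w.i + (pointerVec n w.p + pointerVec n w.q))))
    (pathFun gs (pointerVec n w.p + pointerVec n w.q)))) = _
  cases pathFun gs (w.x + pointerVec n w.i + (pointerVec n w.p + pointerVec n w.q)) <;>
  cases pathFun gs (pointerVec n w.p + pointerVec n w.q) <;> rfl

theorem Work.conf_congr {w' : Work n} (h : w = w') : w.conf gs = w'.conf gs := by rw [h]

/-- Both pointers run through a full cycle, so that together they visit all vectors of weight at
most two, and both end at 0 again. -/
theorem runs_quadTestPrg (hp : w.p = 0) (hq : w.q = 0) (hc : w.carry = false) :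
    Runs quadTestPrg (w.conf gs)
      ({ w with ok := w.ok && quadTest (pathFun gs) (w.x + pointerVec n w.i) }.conf gs)
      ((n + 1) * ((n + 1) * (2 * phaseTime n gs + (2 * n + 2) + 1) + (2 * n + 2) + 1)) := by
  set P : ℕ → ℕ → Prop := fun p q =>
    pathFun gs (w.x + pointerVec n w.i + (pointerVec n p + pointerVec n q)) =
      pathFun gs (pointerVec n p + pointerVec n q) with hP
  have inner : ∀ w' : Work n, w'.x = w.x → w'.i = w.i → w'.q = 0 → w'.carry = false →
      Runs (repeatUntil Reg.pq (comparePrg ;; rotQ)) (w'.conf gs)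
        ({ w' with ok := w'.ok && decide (∀ q < n + 1, P w'.p q) }.conf gs)
        ((n + 1) * (2 * phaseTime n gs + (2 * n + 2) + 1)) := by
    intro w' hx hi hq hc
    have h := runs_repeatUntil (p := Reg.pq) (c := comparePrg ;; rotQ) (N := n)
      (T := 2 * phaseTime n gs + (2 * n + 2))
      -- After `k` rounds the second pointer stands at `k`; after the last round, `k = n + 1`, it
      -- has wrapped around to 0.
      (fun k => ({ w' with q := if k ≤ n then k else 0
                           ok := w'.ok && decide (∀ q < k, P w'.p q) }.conf gs)) ?_ ?_ ?_
    · refine (Eq.subst (motive := fun s => Runs _ s _ _) ?_ h).of ?_ le_rfl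
      · exact Work.conf_congr (by cases w'; simp_all)
      · exact Work.conf_congr (by cases w'; simp_all)
    · intro k hk
      refine (runs_comparePrg.seq runs_rotQ).of (Work.conf_congr ?_) le_rfl
      cases w'
      simp only [Work.mk.injEq] at *
      simp only [hk, if_true, hx, hi, nextPointer]
      refine ⟨trivial, trivial, trivial, trivial, ?_, ?_, trivial, hc.symm, trivial, trivial⟩
      · split <;> split <;> omega
      · rw [Bool.and_assoc]
        congr 1
        rw [Bool.eq_iff_iff]
        simp only [Bool.and_eq_true, decide_eq_true_eq, Nat.lt_succ_iff_lt_or_eq, or_imp,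
          forall_and, forall_eq, hP]
    · intro k hk
      simp [Work.conf, Nat.succ_le_iff.mpr hk]
    · simp [Work.conf]
  have h := runs_repeatUntil (p := Reg.pp)
    (c := repeatUntil Reg.pq (comparePrg ;; rotQ) ;; rotP) (N := n)
    (T := (n + 1) * (2 * phaseTime n gs + (2 * n + 2) + 1) + (2 * n + 2))
    (fun k => ({ w with p := if k ≤ n then k else 0
                        ok := w.ok && decide (∀ p < k, ∀ q < n + 1, P p q) }.conf gs)) ?_ ?_ ?_
  · refine (Eq.subst (motive := fun s => Runs _ s _ _) ?_ h).of ?_ le_rfl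
    · exact Work.conf_congr (by cases w; simp_all)
    · exact Work.conf_congr (by cases w; simp_all [quadTest])
  · intro k hk
    refine ((inner { w with
      p := if k ≤ n then k else 0
      ok := w.ok && decide (∀ p < k, ∀ q < n + 1, P p q) } rfl rfl hq hc).seq runs_rotP).of (Work.conf_congr ?_) le_rfl
    cases w
    simp only [Work.mk.injEq] at *
    simp only [hk, if_true, nextPointer]
    refine ⟨trivial, trivial, trivial, ?_, trivial, ?_, trivial, hc.symm, trivial, trivial⟩
    · split <;> split <;> omega
    · rw [Bool.and_assoc]
      congr 1
      rw [Bool.eq_iff_iff]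
      simp only [Bool.and_eq_true, decide_eq_true_eq, Nat.lt_succ_iff_lt_or_eq, or_imp,
        forall_and, forall_eq]
      tauto
  · intro k hk
    simp [Work.conf, Nat.succ_le_iff.mpr hk]
  · simp [Work.conf]

end

section

variable {ℓ n : ℕ} {gs : List (QGate ℓ)} {w : Work n}

/-- A bound for the time of one test. -/
def quadTestTime {ℓ : ℕ} (n : ℕ) (gs : List (QGate ℓ)) : ℕ :=
  (n + 1) * ((n + 1) * (2 * phaseTime n gs + (2 * n + 2) + 1) + (2 * n + 2) + 1)

/-- The search always enumerates all assignments, even after a success; the exit signal is the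
overflow of the counter. -/
theorem runs_searchPrg (hx : w.x = fun _ => false) (hp : w.p = 0) (hq : w.q = 0)
    (hok : w.ok = false) (hf : w.found = false) (hc : w.carry = false) :
    Runs searchPrg (w.conf gs) ({ w with found := searchTest (pathFun gs) w.b w.i }.conf gs)
      (2 ^ numSelected w.b * (quadTestTime n gs + (2 * n + 2) + 1)) := by
  obtain ⟨N, hN⟩ : ∃ N, 2 ^ numSelected w.b = N + 1 :=
    ⟨_, (Nat.succ_pred (by positivity)).symm⟩
  have h := runs_repeatUntil (p := Reg.carry)
    (c := .load (fun v => { v with ok := true }) ;; quadTestPrg ;;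
      .load (fun v => { v with found := v.found || v.ok, ok := false }) ;; incrementPrg) (N := N)
    (T := quadTestTime n gs + (2 * n + 2))
    (fun k => ({ w with
      x := counterBits w.b k
      carry := decide (k = N + 1)
      found := decide (∃ t < k, quadTest (pathFun gs) (counterBits w.b t + pointerVec n w.i)) }
      : Work n).conf gs) ?_ ?_ ?_
  · rw [searchPrg, hN]
    refine ((Eq.subst (motive := fun s => Runs _ s _ _) ?_ h).seq
      (Runs.straight rfl rfl)).of ?_ le_rfl
    · exact Work.conf_congr (by cases w; simp_all [counterBits_zero])
    · have := counterBits_two_pow w.b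
      rw [hN] at this
      simp only [Cmd.eval, Work.conf, this]
      cases w
      simp_all only [searchTest]
      rfl
  · intro k hk
    have h₁ := runs_quadTestPrg (gs := gs) (w := { w with
      x := counterBits w.b k
      ok := true
      carry := decide (k = N + 1)
      found := decide (∃ t < k, quadTest (pathFun gs) (counterBits w.b t + pointerVec n w.i)) })
      hp hq (by simp; omega)
    have h₂ := runs_incrementPrg (gs := gs) (w := { w with
      x := counterBits w.b k
      ok := false
      carry := decide (k = N + 1)
      found := decide (∃ t < k, quadTest (pathFun gs) (counterBits w.b t + pointerVec n w.i)) ||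
        (true && quadTest (pathFun gs) (counterBits w.b k + pointerVec n w.i)) }) (t := k)
      (by dsimp only; omega) rfl
    refine ((Runs.straight rfl rfl).seq (h₁.seq ((Runs.straight rfl rfl).seq h₂))).of
      (Work.conf_congr ?_) (by simp [quadTestTime])
    cases w
    simp only [Work.mk.injEq] at *
    refine ⟨trivial, trivial, trivial, trivial, trivial, hok.symm, ?_, by rw [hN], trivial, trivial⟩
    rw [Bool.eq_iff_iff]
    simp only [Bool.or_eq_true, decide_eq_true_eq, Bool.true_and, Nat.lt_succ_iff_lt_or_eq,
      or_and_right, exists_or, exists_eq_left]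
  · intro k hk
    simp [Work.conf, hk.ne]
  · simp [Work.conf]

/-- Each search is exponential in the size of the current selection, so the bound `d` is required at
every stage and not only at the end. -/
theorem runs_greedyPrg {d : ℕ} (hb : ∀ k ≤ n, numSelected (greedy (n := n) (pathFun gs) k) ≤ d) :
    Runs greedyPrg (({} : Work n).conf gs)
      (({ b := greedy (pathFun gs) n } : Work n).conf gs)
      ((n + 1) * ((2 * n + 2) + 2 ^ d * (quadTestTime n gs + (2 * n + 2) + 1) + (2 * n + 2) + 1)) :=
    by
  have h := runs_repeatUntil (p := Reg.pi)
    (c := rotI ;; .ite Reg.pi .skip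
      (searchPrg ;; .ite Reg.found .skip selectPrg ;; .load fun v => { v with found := false }))
    (N := n)
    (T := (2 * n + 2) + 2 ^ d * (quadTestTime n gs + (2 * n + 2) + 1) + (2 * n + 2))
    (fun k => ({ b := greedy (pathFun gs) (min k n), i := if k ≤ n then k else 0 } :
      Work n).conf gs) ?_ ?_ ?_
  · refine (Eq.subst (motive := fun s => Runs _ s _ _) ?_ h).of ?_ le_rfl
    · exact Work.conf_congr (by simp [greedy])
    · exact Work.conf_congr (by simp)
  · intro k hk
    simp only [hk, if_true, min_eq_left]
    have h₁ := runs_rotI (gs := gs) (w := ({ b := greedy (pathFun gs) k, i := k } : Work n))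
    -- The last of the `n + 1` rounds only brings the candidate pointer back to 0.
    rcases hk.lt_or_eq with hk' | rfl
    · have e : nextPointer n k = k + 1 := by simp [nextPointer, hk'.ne]
      simp only [e] at h₁
      have h₂ := runs_searchPrg (gs := gs)
        (w := ({ b := greedy (pathFun gs) k, i := k + 1 } : Work n)) rfl rfl rfl rfl rfl rfl
      have h₃ : Runs (searchPrg ;; .ite Reg.found .skip selectPrg ;;
          .load fun v => { v with found := false })
          (({ b := greedy (pathFun gs) k, i := k + 1 } : Work n).conf gs)
          (({ b := greedy (pathFun gs) (k + 1), i := k + 1 } : Work n).conf gs)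
          (2 ^ d * (quadTestTime n gs + (2 * n + 2) + 1) + (2 * n + 2)) := by
        have hd : 2 ^ numSelected (greedy (pathFun gs) k : Fin n → Bool) ≤ 2 ^ d :=
          Nat.pow_le_pow_right two_pos (hb k hk)
        cases hs : searchTest (n := n) (pathFun gs) (greedy (pathFun gs) k) (k + 1)
        · simp only [hs] at h₂
          refine (h₂.seq ((Runs.iteFalse rfl runs_selectPrg).seq (Runs.straight rfl rfl))).of
            ?_ (Nat.add_le_add (Nat.mul_le_mul_right _ hd) le_rfl)
          simp only [greedy, hs]
          rfl
        · simp only [hs] at h₂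
          refine (h₂.seq ((Runs.iteTrue rfl .skip).seq (Runs.straight rfl rfl))).of
            ?_ (Nat.add_le_add (Nat.mul_le_mul_right _ hd) (Nat.zero_le _))
          simp only [greedy, hs, if_true]
          rfl
      refine (h₁.seq (.iteFalse (by simp [Work.conf]) h₃)).of (Work.conf_congr ?_) (by omega)
      simp [Nat.succ_le_iff.mpr hk']
    · have e : nextPointer k k = 0 := by simp [nextPointer]
      simp only [e] at h₁
      refine (h₁.seq (.iteTrue (by simp [Work.conf]) .skip)).of (Work.conf_congr ?_) (by omega)
      simp
  · intro k hk
    simp [Work.conf, Nat.succ_le_iff.mpr hk]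
  · simp [Work.conf]

/-- The number of assignments to the selected coordinates, among the first `k`, on which `f` is
`v`. -/
def countValue {n : ℕ} (f : (Fin n → Bool) → Bool) (B : Fin n → Bool) (v : Bool) (k : ℕ) : ℕ :=
  ((Finset.range k).filter fun t => f (counterBits B t) = v).card

theorem countValue_succ (f : (Fin n → Bool) → Bool) (B : Fin n → Bool) (v : Bool) (k : ℕ) :
    countValue f B v (k + 1) = countValue f B v k + if f (counterBits B k) = v then 1 else 0 := by
  rw [countValue, Finset.range_add_one, Finset.filter_insert]
  split
  · rw [Finset.card_insert_of_notMem (by simp)]; rfl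
  · rfl

theorem runs_countPrg (B : Fin n → Bool) :
    Runs countPrg (({ b := B } : Work n).conf gs)
      (({ b := B, n₀ := countValue (pathFun gs) B false (2 ^ numSelected B)
          n₁ := countValue (pathFun gs) B true (2 ^ numSelected B) } : Work n).conf gs)
      (2 ^ numSelected B * (phaseTime n gs + (2 * n + 2) + 1)) := by
  obtain ⟨N, hN⟩ : ∃ N, 2 ^ numSelected B = N + 1 :=
    ⟨_, (Nat.succ_pred (by positivity)).symm⟩
  have h := runs_repeatUntil (p := Reg.carry)
    (c := phasePrg TapeCell.x ;;
      .ite Reg.ph (.push .unaAux fun _ => true) (.push .una fun _ => true) ;;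
      .load (fun v => { v with ph := false }) ;; incrementPrg) (N := N)
    (T := phaseTime n gs + (2 * n + 2))
    (fun k => ({
      b := B
      x := counterBits B k
      carry := decide (k = N + 1)
      n₀ := countValue (pathFun gs) B false k
      n₁ := countValue (pathFun gs) B true k } : Work n).conf gs) ?_ ?_ ?_
  · rw [countPrg, hN]
    refine ((Eq.subst (motive := fun s => Runs _ s _ _) ?_ h).seq
      (Runs.straight rfl rfl)).of ?_ le_rfl
    · exact Work.conf_congr (by simp [counterBits_zero, countValue])
    · have := counterBits_two_pow B
      rw [hN] at this
      simp only [Cmd.eval, Work.conf, this]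
      rfl
  · intro k hk
    have h₁ := runs_phasePrg_conf (gs := gs) (w := ({
      b := B
      x := counterBits B k
      n₀ := countValue (pathFun gs) B false k
      n₁ := countValue (pathFun gs) B true k } : Work n)) TapeCell.x {} ⟨rfl, rfl, rfl, rfl, rfl⟩
        rfl
    have h₂ := runs_incrementPrg (gs := gs) (w := ({
      b := B
      x := counterBits B k
      n₀ := countValue (pathFun gs) B false (k + 1)
      n₁ := countValue (pathFun gs) B true (k + 1) } : Work n)) (t := k) (by dsimp only; omega) rfl
    have hc : decide (k = N + 1) = false := by simp; omega
    rw [hN] at h₂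
    change Runs _ _ ⟨{ ph := xor false (pathFun gs (counterBits B k)) }, _⟩ _ at h₁
    rw [Bool.false_xor] at h₁
    simp only [hc]
    simp only [countValue_succ] at h₂ ⊢
    cases hv : pathFun gs (counterBits B k) <;> rw [hv] at h₁ h₂
    · exact (h₁.seq ((Runs.iteFalse rfl (Runs.straight rfl rfl)).seq
        ((Runs.straight rfl rfl).seq h₂))).of rfl (by omega)
    · exact (h₁.seq ((Runs.iteTrue rfl (Runs.straight rfl rfl)).seq
        ((Runs.straight rfl rfl).seq h₂))).of rfl (by omega)
  · intro k hk
    simp [Work.conf, hk.ne]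
  · simp [Work.conf]

end

/-! ### Reading the input -/

theorem runs_forEach_stop {k : StackName} {f : Reg → Option (StackAlphabet k) → Reg}
    {p : Reg → Bool} {body : Prg} {v : Reg} {m : Mem} {a : StackAlphabet k}
    {l : List (StackAlphabet k)} (hk : m.get k = a :: l) (hp : p (f v (some a)) = false) :
    Runs (forEach k f p body) ⟨v, m⟩ ⟨f v (some a), m.set k l⟩ 1 := by
  refine ((Runs.straight (c := .pop k f) rfl (s' := ⟨f v (some a), m.set k l⟩) ?_).seq
    (Runs.loopFalse hp)).mono le_rfl
  rw [Cmd.eval, hk, List.head?_cons, List.tail_cons]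

/-- The number of Hadamard gates that are named in a description. -/
def countTagH (l : List CircuitSymbol) : ℕ := l.countP CircuitSymbol.isTagH

/-- Read the number of qubits and make the wires. -/
def readWiresPrg : Prg :=
  forEach .inp Reg.setSym (fun v => v.symD.isTally) (.push .wire fun _ => false)

/-- Read the gates and make a cell for each Hadamard gate. -/
def readGatesPrg : Prg :=
  forEach .inp Reg.setSym (fun v => v.sym.isSome) (.push .gateAux Reg.symD ;;
    .ite (fun v => v.symD.isTagH) (.push .tape fun _ => .blank) .skip)

/-- Remove a cell for each qubit. -/
def shortenPrg : Prg :=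
  forEach .wire Reg.setBit (fun v => v.bit.isSome) (.push .wireAux Reg.bitD ;;
    .pop .tape fun v _ => v) ;; rewindWire

/-- Read the input. -/
def readPrg : Prg := readWiresPrg ;; readGatesPrg ;; rewindGate ;; shortenPrg

theorem runs_readWiresPrg {g : List CircuitSymbol} (ℓ : ℕ) (v : Reg) (m : Mem)
    (hm : m.inp = encodeUnary ℓ ++ g) :
    Runs readWiresPrg ⟨v, m⟩ ⟨{ v with sym := some .sep },
      { m with inp := g, wire := List.replicate ℓ false ++ m.wire }⟩ (ℓ + 1) := by
  induction ℓ generalizing v m with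
  | zero => exact (runs_forEach_stop (k := .inp) hm rfl).of rfl le_rfl
  | succ ℓ ih =>
    refine (runs_forEach_cons (k := .inp) hm rfl (Runs.straight rfl rfl) (ih _ _ rfl)).of ?_
      (by omega)
    simp [Mem.set, Mem.get, Reg.setSym, List.replicate_succ']

theorem runs_readGatesPrg (l : List CircuitSymbol) (v : Reg) (m : Mem) (hm : m.inp = l) :
    Runs readGatesPrg ⟨v, m⟩ ⟨{ v with sym := none },
      { m with inp := [], gateAux := l.reverse ++ m.gateAux
               tape := List.replicate (countTagH l) .blank ++ m.tape }⟩ (l.length + 1) := by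
  induction l generalizing v m with
  | nil =>
    refine (runs_forEach_nil (k := .inp) hm rfl).of ?_ le_rfl
    cases m
    simp_all [Reg.setSym, countTagH]
  | cons a l ih =>
    cases h : a.isTagH
    · refine (runs_forEach_cons (k := .inp) hm rfl ((Runs.straight rfl rfl).seq
        (Runs.iteFalse h .skip)) (ih _ _ rfl)).of ?_ (by simp)
      simp [Mem.set, Mem.get, Reg.setSym, Reg.symD, countTagH, h]
    · refine (runs_forEach_cons (k := .inp) hm rfl ((Runs.straight rfl rfl).seq
        (Runs.iteTrue h (Runs.straight rfl rfl))) (ih _ _ rfl)).of ?_ (by simp)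
      simp [Mem.set, Mem.get, Reg.setSym, Reg.symD, countTagH, h, List.replicate_succ']

theorem runs_shortenPrg (v : Reg) (m : Mem) (hm : m.wireAux = []) :
    Runs shortenPrg ⟨v, m⟩ ⟨{ v with bit := none }, { m with tape := m.tape.drop m.wire.length }⟩
      (2 * m.wire.length + 2) := by
  suffices h : ∀ (l : List Bool) (v : Reg) (m : Mem), m.wire = l →
      Runs (forEach .wire Reg.setBit (fun v => v.bit.isSome) (.push .wireAux Reg.bitD ;;
        .pop .tape fun v _ => v)) ⟨v, m⟩
      ⟨{ v with bit := none },
        { m with wire := [], wireAux := l.reverse ++ m.wireAux, tape := m.tape.drop l.length }⟩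
      (l.length + 1) by
    refine ((h _ v m rfl).seq (runs_rewindWire _ _)).of ?_ ?_
    · simp [hm]
    · simp [hm]
      omega
  intro l
  induction l with
  | nil =>
    intro v m hl
    refine (runs_forEach_nil (k := .wire) hl rfl).of ?_ (by simp)
    cases m
    simp_all [Reg.setBit]
  | cons a l ih =>
    intro v m hl
    refine (runs_forEach_cons (k := .wire) hl rfl (Runs.straight rfl rfl) (ih _ _ rfl)).of ?_ ?_
    · simp [Mem.set, Mem.get, Reg.setBit, Reg.bitD]
    · simp

/-- One cell is made for each Hadamard gate, and `ℓ` cells are removed, because the last column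
introduces no variables. -/
theorem runs_readPrg {ℓ n : ℕ} (gs : List (QGate ℓ))
    (hn : countTagH (gs.flatMap QGate.encode) - ℓ = n) :
    Runs readPrg ⟨{}, { inp := encodeUnary ℓ ++ gs.flatMap QGate.encode }⟩
      (({} : Work n).conf gs) (2 * (gs.flatMap QGate.encode).length + 3 * ℓ + 5) := by
  refine ((runs_readWiresPrg ℓ _ _ rfl).seq ((runs_readGatesPrg _ _ _ rfl).seq
    ((runs_rewindGate _ _).seq (runs_shortenPrg _ _ rfl)))).of ?_ ?_
  · have : ({} : Work n).cell = fun _ => TapeCell.blank := by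
      funext j
      simp [Work.cell, pointerVec, TapeCell.blank]
    simp [Work.conf, this, hn, List.drop_replicate, List.ofFn_const]
  · simp
    omega

/-! ### Writing the output -/

/-- Pop a tally mark from each of the unary counters. -/
def popPairPrg : Prg := .pop .una Reg.setBit ;; .pop .unaAux fun v o => { v with bit' := o }

/-- Cancel the two unary counters against each other; `found` becomes the sign of the difference.
-/
def cancelPrg : Prg :=
  (popPairPrg ;; .loop (fun v => v.bit.isSome && v.bit'.isSome) popPairPrg) ;;
  .load (fun v => { v with found := v.bit'.isSome }) ;;
  (.ite (fun v => v.bit.isSome) (.push .una fun _ => true) .skip ;;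
  .ite (fun v => v.bit'.isSome) (.push .unaAux fun _ => true) .skip ;;
  .load fun v => { v with bit := none, bit' := none })

/-- Divide the unary counter by two, and put the remainder into `acc`. -/
def halvePrg : Prg :=
  forEach .una Reg.setBit (fun v => v.bit.isSome)
    (.load (fun v => { v with acc := !v.acc }) ;;
      .ite Reg.acc .skip (.push .unaAux fun _ => true))

/-- Add the second unary counter to the first one. -/
def mergePrg : Prg :=
  forEach .unaAux Reg.setBit (fun v => v.bit.isSome) (.push .una fun _ => true)

/-- Convert the unary counter to binary. -/
def binaryPrg : Prg :=
  forEach .una Reg.setBit (fun v => v.bit.isSome)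
    ((.push .una fun _ => true) ;; halvePrg ;; .push .bits Reg.acc ;;
      .load (fun v => { v with acc := false }) ;; mergePrg)

/-- Write the binary digits, and keep in `acc` whether there are any. -/
def writeBitsPrg : Prg :=
  forEach .bits Reg.setBit (fun v => v.bit.isSome)
    (.push .out (fun v => v.bit) ;; .load fun v => { v with acc := true })

/-- Write a zero for each coordinate that is not selected, unless the number is zero. -/
def writeZerosPrg : Prg :=
  forEach .tape Reg.setCell (fun v => v.cell.isSome)
    (.ite (fun v => v.acc && !v.cellD.b) (.push .out fun _ => some false) .skip)

/-- Write a mark for each Hadamard gate. -/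
def writeRootsPrg : Prg :=
  forEach .gate Reg.setSym (fun v => v.sym.isSome)
    (.ite (fun v => v.symD.isTagH) (.push .out fun _ => none) .skip)

/-- Write the output, and empty the other stacks. -/
def writePrg : Prg :=
  cancelPrg ;; mergePrg ;; binaryPrg ;; writeBitsPrg ;; writeZerosPrg ;;
  .push .out (fun v => some v.found) ;; writeRootsPrg ;;
  forEach .wire Reg.setBit (fun v => v.bit.isSome) .skip ;; .load fun _ => {}

/-- Popping in pairs stops at the first missing mark. At most one mark of the final pair is present;
it is put back, and its side gives the sign. -/
theorem runs_cancelPrg (a b : ℕ) (v : Reg) (m : Mem) (ha : m.una = List.replicate a true)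
    (hb : m.unaAux = List.replicate b true) :
    Runs cancelPrg ⟨v, m⟩ ⟨{ v with bit := none, bit' := none, found := decide (a < b) },
      { m with una := List.replicate (a - b) true, unaAux := List.replicate (b - a) true }⟩
      (a + 1) := by
  suffices h : Runs (popPairPrg ;; .loop (fun v => v.bit.isSome && v.bit'.isSome) popPairPrg)
      ⟨v, m⟩ ⟨{ v with bit := (List.replicate (a - b) true).head?
                       bit' := (List.replicate (b - a) true).head? },
      { m with una := (List.replicate (a - b) true).tail
               unaAux := (List.replicate (b - a) true).tail }⟩ (a + 1) by
    refine (h.seq ((Runs.straight rfl rfl).seq (Runs.straight rfl rfl))).of ?_ le_rfl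
    rcases lt_trichotomy a b with h | h | h
    · obtain ⟨d, rfl⟩ := Nat.exists_eq_add_of_lt h
      have e : a - (a + d + 1) = 0 := by omega
      have e' : a + d + 1 - a = d + 1 := by omega
      rw [e, e']
      simp [Cmd.eval, Mem.set, Mem.get, List.replicate_succ]
    · subst h
      simp [Cmd.eval]
    · obtain ⟨d, rfl⟩ := Nat.exists_eq_add_of_lt h
      have e : b - (b + d + 1) = 0 := by omega
      have e' : b + d + 1 - b = d + 1 := by omega
      rw [e, e']
      simp [Cmd.eval, Mem.set, Mem.get, List.replicate_succ]
      omega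
  have hp : ∀ v m, popPairPrg.eval ⟨v, m⟩ = ⟨{ v with bit := m.una.head?, bit' := m.unaAux.head? },
      { m with una := m.una.tail, unaAux := m.unaAux.tail }⟩ := fun _ _ => rfl
  induction a generalizing b v m with
  | zero =>
    refine ((Runs.straight rfl (hp v m)).seq (Runs.loopFalse ?_)).of ?_ le_rfl
    · simp [ha]
    · simp [ha, hb]
  | succ a ih =>
    rcases b with _ | b
    · refine ((Runs.straight rfl (hp v m)).seq (Runs.loopFalse ?_)).of ?_ (by omega)
      · simp [hb]
      · simp [ha, hb]
    -- The run from the induction hypothesis also begins with a pop of a pair; here this pop is the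
    -- body of the loop.
    · obtain ⟨u, hu, e⟩ := ih b { v with bit := m.una.head?, bit' := m.unaAux.head? }
        { m with una := m.una.tail, unaAux := m.unaAux.tail } (by simp [ha]) (by simp [hb])
      obtain ⟨u', hu', e'⟩ := Runs.straight rfl (hp v m)
      cases e with
      | @seq _ _ _ _ _ t₁ t₂ e₁ e₂ =>
        refine Runs.of ⟨u' + (t₁ + t₂ + 1), by omega, .seq e' (.loopTrue ?_ e₁ e₂)⟩ ?_ le_rfl
        · simp [ha, hb]
        · simp [Nat.add_sub_add_right]

theorem runs_mergePrg (v : Reg) (m : Mem) :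
    Runs mergePrg ⟨v, m⟩ ⟨{ v with bit := none },
      { m with una := List.replicate m.unaAux.length true ++ m.una, unaAux := [] }⟩
      (m.unaAux.length + 1) := by
  have h := runs_transfer (k := .unaAux) (j := .una) (by decide) (f := Reg.setBit)
    (p := fun v => v.bit.isSome) (g := fun _ => true) (fun _ => true) (fun _ _ => rfl)
    (fun _ _ _ => rfl) (fun _ _ => rfl) v m
  refine h.of ?_ le_rfl
  simp [Mem.get, Mem.set, Reg.setBit]

theorem runs_halvePrg (n : ℕ) (v : Reg) (m : Mem) (hm : m.una = List.replicate n true) :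
    Runs halvePrg ⟨v, m⟩ ⟨{ v with bit := none, acc := decide ((n + v.acc.toNat) % 2 = 1) },
      { m with una := []
               unaAux := List.replicate ((n + v.acc.toNat) / 2) true ++ m.unaAux }⟩ (n + 1) := by
  induction n generalizing v m with
  | zero =>
    refine (runs_forEach_nil (k := .una) hm rfl).of ?_ le_rfl
    cases m; cases v with | mk _ _ _ _ _ acc =>
    cases acc <;> simp_all [Reg.setBit]
  | succ n ih =>
    cases h : v.acc
    · refine (runs_forEach_cons (k := .una) hm rfl ((Runs.straight rfl rfl).seq
        (Runs.iteTrue (by simp [Reg.setBit, Cmd.eval, h]) .skip)) (ih _ _ rfl)).of ?_ (by omega)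
      simp [Mem.set, Reg.setBit, h]
    · have e : (n + 1 + 1) / 2 = n / 2 + 1 := by omega
      have e' : (n + 1 + 1) % 2 = n % 2 := by omega
      refine (runs_forEach_cons (k := .una) hm rfl ((Runs.straight rfl rfl).seq
        (Runs.iteFalse (by simp [Reg.setBit, Cmd.eval, h]) (Runs.straight rfl rfl)))
        (ih _ _ rfl)).of ?_ (by omega)
      simp [Mem.set, Mem.get, Reg.setBit, h, e, e', List.replicate_succ']

theorem Nat.bits_eq_cons {n : ℕ} (hn : n ≠ 0) :
    n.bits = decide (n % 2 = 1) :: (n / 2).bits := by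
  rcases Nat.mod_two_eq_zero_or_one n with h | h
  · conv_lhs => rw [show n = 2 * (n / 2) by omega]
    rw [Nat.bit0_bits _ (by omega)]
    simp [h]
  · conv_lhs => rw [show n = 2 * (n / 2) + 1 by omega]
    rw [Nat.bit1_bits]
    simp [h]

/-- Repeated halving yields the digits, the least significant first. The loop test takes a mark,
which the body restores before halving. A round costs about one and a half times the counter and
halves it, so the total is linear; the factor 8 is generous. -/
theorem runs_binaryPrg (n : ℕ) (v : Reg) (m : Mem) (hm : m.una = List.replicate n true)
    (hm' : m.unaAux = []) (hv : v.acc = false) :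
    Runs binaryPrg ⟨v, m⟩ ⟨{ v with bit := none },
      { m with una := [], bits := n.bits.reverse ++ m.bits }⟩ (8 * n + 1) := by
  induction n using Nat.strong_induction_on generalizing v m with
  | _ n ih =>
    rcases n with _ | n
    · refine (runs_forEach_nil (k := .una) hm rfl).of ?_ le_rfl
      cases m
      simp_all [Reg.setBit]
    · have h := ih ((n + 1) / 2) (by omega)
      refine (runs_forEach_cons (k := .una) hm rfl ((Runs.straight rfl rfl).seq
        ((runs_halvePrg (n + 1) _ _ rfl).seq ((Runs.straight rfl rfl).seq
        ((Runs.straight rfl rfl).seq (runs_mergePrg _ _))))) (h _ _ ?_ ?_ ?_)).of ?_ ?_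
      · simp [Mem.set, Mem.get, Cmd.eval, hm', hv, Reg.setBit]
      · simp
      · simp [Mem.set, Mem.get, Cmd.eval]
      · simp [Mem.set, Mem.get, Cmd.eval, hm', hv, Reg.setBit, Nat.bits_eq_cons (Nat.succ_ne_zero n)]
      · simp [Mem.set, Mem.get, Cmd.eval, hm', hv, Reg.setBit]
        omega

theorem runs_writeBitsPrg (l : List Bool) (v : Reg) (m : Mem) (hm : m.bits = l) :
    Runs writeBitsPrg ⟨v, m⟩ ⟨{ v with bit := none, acc := v.acc || decide (l ≠ []) },
      { m with bits := [], out := l.reverse.map some ++ m.out }⟩ (l.length + 1) := by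
  induction l generalizing v m with
  | nil =>
    refine (runs_forEach_nil (k := .bits) hm rfl).of ?_ le_rfl
    cases m
    simp_all [Reg.setBit]
  | cons a l ih =>
    refine (runs_forEach_cons (k := .bits) hm rfl (Runs.straight rfl rfl) (ih _ _ rfl)).of ?_
      (by simp)
    simp [Mem.set, Mem.get, Reg.setBit]

theorem runs_writeZerosPrg (l : List TapeCell) (v : Reg) (m : Mem) (hm : m.tape = l) :
    Runs writeZerosPrg ⟨v, m⟩ ⟨{ v with cell := none },
      { m with tape := []
               out := List.replicate (l.countP fun a => v.acc && !a.b) (some false) ++ m.out }⟩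
      (l.length + 1) := by
  induction l generalizing v m with
  | nil =>
    refine (runs_forEach_nil (k := .tape) hm rfl).of ?_ le_rfl
    cases m
    simp_all [Reg.setCell]
  | cons a l ih =>
    cases h : (v.acc && !a.b)
    · refine (runs_forEach_cons (k := .tape) hm rfl (Runs.iteFalse h .skip) (ih _ _ rfl)).of ?_
        (by simp)
      simp [Mem.set, Reg.setCell, h]
    · refine (runs_forEach_cons (k := .tape) hm rfl (Runs.iteTrue h (Runs.straight rfl rfl))
        (ih _ _ rfl)).of ?_ (by simp)
      simp [Mem.set, Mem.get, Reg.setCell, h, List.replicate_succ']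

theorem runs_writeRootsPrg (l : List CircuitSymbol) (v : Reg) (m : Mem) (hm : m.gate = l) :
    Runs writeRootsPrg ⟨v, m⟩ ⟨{ v with sym := none },
      { m with gate := [], out := List.replicate (countTagH l) none ++ m.out }⟩
      (l.length + 1) := by
  induction l generalizing v m with
  | nil =>
    refine (runs_forEach_nil (k := .gate) hm rfl).of ?_ le_rfl
    cases m
    simp_all [Reg.setSym, countTagH]
  | cons a l ih =>
    cases h : a.isTagH
    · refine (runs_forEach_cons (k := .gate) hm rfl (Runs.iteFalse h .skip) (ih _ _ rfl)).of ?_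
        (by simp)
      simp [Mem.set, Reg.setSym, countTagH, h]
    · refine (runs_forEach_cons (k := .gate) hm rfl (Runs.iteTrue h (Runs.straight rfl rfl))
        (ih _ _ rfl)).of ?_ (by simp)
      simp [Mem.set, Mem.get, Reg.setSym, countTagH, h, List.replicate_succ']

theorem runs_drainWire (l : List Bool) (v : Reg) (m : Mem) (hm : m.wire = l) :
    Runs (forEach .wire Reg.setBit (fun v => v.bit.isSome) .skip) ⟨v, m⟩
      ⟨{ v with bit := none }, { m with wire := [] }⟩ (l.length + 1) := by
  induction l generalizing v m with
  | nil =>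
    refine (runs_forEach_nil (k := .wire) hm rfl).of ?_ le_rfl
    cases m
    simp_all [Reg.setBit]
  | cons a l ih =>
    exact (runs_forEach_cons (k := .wire) hm rfl Runs.skip (ih _ _ rfl)).of rfl (by simp)

section

variable {ℓ n : ℕ} {gs : List (QGate ℓ)}

theorem numSelected_le (B : Fin n → Bool) : numSelected B ≤ n := by
  refine (Finset.sum_le_card_nsmul Finset.univ _ 1 fun j _ => ?_).trans (by simp)
  exact Nat.lt_succ_iff.mp (Bool.toNat_lt _)

theorem countP_ofFn_cell (w : Work n) :
    (List.ofFn w.cell).countP (fun a => !a.b) = n - numSelected w.b := by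
  suffices h : ∀ (n : ℕ) (f : Fin n → TapeCell),
      (List.ofFn f).countP (fun a => !a.b) + numSelected (fun j => (f j).b) = n by
    have := h n w.cell
    simp only [Work.cell] at this
    change (List.ofFn w.cell).countP (fun a => !a.b) + numSelected w.b = n at this
    omega
  intro n f
  induction n with
  | zero => simp [numSelected]
  | succ n ih =>
    have := ih fun j => f j.succ
    rw [List.ofFn_succ, numSelected_succ, List.countP_cons]
    change _ + (_ + numSelected fun j => (f (Fin.succ j)).b) = _
    cases (f 0).b <;> simp <;> omega

theorem bits_two_pow_mul (z : ℕ) {m : ℕ} (hm : m ≠ 0) :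
    (2 ^ z * m).bits = List.replicate z false ++ m.bits := by
  induction z with
  | zero => simp
  | succ z ih =>
    rw [pow_succ', mul_assoc, Nat.bit0_bits _ (by positivity), ih, List.replicate_succ]
    rfl

/-- With the least significant digit first, a factor `2 ^ z` puts `z` zeros in front, except that
the number zero has no digits at all. The two truncated differences add up to the absolute value. -/
theorem encodeAmplitude_two_pow_mul (a b z k : ℕ) :
    encodeAmplitude (2 ^ z * ((a : ℤ) - b)) k =
      List.replicate k none ++ some (decide (a < b)) ::
        (List.replicate (if a = b then 0 else z) (some false) ++
          ((a - b) + (b - a)).bits.map some) := by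
  have h₁ : (2 ^ z * ((a : ℤ) - b) < 0) ↔ a < b := by
    refine ⟨fun h => ?_, fun h => mul_neg_of_pos_of_neg (by positivity) (by omega)⟩
    by_contra hab
    exact absurd h (not_lt.mpr (mul_nonneg (by positivity) (by omega)))
  have h₂ : (2 ^ z * ((a : ℤ) - b)).natAbs = 2 ^ z * ((a - b) + (b - a)) := by
    rw [Int.natAbs_mul, Int.natAbs_pow]
    congr 1
    omega
  rw [encodeAmplitude, h₂]
  simp only [h₁]
  congr 2
  split
  next h => simp [h]
  next h => rw [bits_two_pow_mul z (by omega), List.map_append, List.map_replicate]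

/-- The output is a stack and is written from its end: digits, then one zero per unselected
coordinate, then the sign, then a mark per Hadamard gate. The factor `2 ^ (n - numSelected B)` is
thus never computed. -/
theorem runs_writePrg (B : Fin n → Bool) (n₀ n₁ : ℕ) :
    Runs writePrg (({ b := B, n₀ := n₀, n₁ := n₁ } : Work n).conf gs)
      { mem.out := encodeAmplitude (2 ^ (n - numSelected B) * ((n₀ : ℤ) - n₁))
          (countTagH (gs.flatMap QGate.encode)) }
      (11 * (n₀ + n₁) + n + (gs.flatMap QGate.encode).length + ℓ + 7) := by
  set d := (n₀ - n₁) + (n₁ - n₀) with hd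
  have hd' : d ≤ n₀ + n₁ := by omega
  -- The number of digits is at most `d` because `d < 2 ^ d`.
  have hb : d.bits.length ≤ d := by
    rw [Nat.size_eq_bits_len]
    exact Nat.size_le.mpr Nat.lt_two_pow_self
  set w : Work n := { b := B, n₀ := n₀, n₁ := n₁ } with hw
  set g := gs.flatMap QGate.encode with hg
  set z := if n₀ = n₁ then 0 else n - numSelected B with hz
  have h₁ := runs_cancelPrg n₀ n₁ (w.conf gs).reg (w.conf gs).mem rfl rfl
  have h₂ : Runs mergePrg _ ⟨{ found := decide (n₀ < n₁) },
      { gate := g, wire := List.replicate ℓ false, tape := List.ofFn w.cell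
        una := List.replicate d true }⟩ (d + 1) := (runs_mergePrg { found := decide (n₀ < n₁) }
      { gate := g, wire := List.replicate ℓ false, tape := List.ofFn w.cell
        una := List.replicate (n₀ - n₁) true, unaAux := List.replicate (n₁ - n₀) true }).of
      (by simp [hd, add_comm]) (by simp [hd])
  have h₃ := (runs_binaryPrg d { found := decide (n₀ < n₁) }
      { gate := g, wire := List.replicate ℓ false, tape := List.ofFn w.cell
        una := List.replicate d true } rfl rfl rfl)
  have h₄ : Runs writeBitsPrg _ ⟨{ found := decide (n₀ < n₁), acc := decide (n₀ ≠ n₁) },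
      { gate := g, wire := List.replicate ℓ false, tape := List.ofFn w.cell
        out := d.bits.map some }⟩ (d + 1) := (runs_writeBitsPrg (d.bits.reverse ++ [])
      { found := decide (n₀ < n₁) }
      { gate := g, wire := List.replicate ℓ false, tape := List.ofFn w.cell
        bits := d.bits.reverse ++ [] } rfl).of
      (by
        have : d.bits = [] ↔ n₀ = n₁ := by
          rw [← List.length_eq_zero_iff, Nat.size_eq_bits_len, Nat.size_eq_zero]
          omega
        simp [this]) (by simpa using hb)
  have h₅ : Runs writeZerosPrg _ ⟨{ found := decide (n₀ < n₁), acc := decide (n₀ ≠ n₁) },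
      { gate := g, wire := List.replicate ℓ false
        out := List.replicate z (some false) ++ d.bits.map some }⟩ (n + 1) :=
    (runs_writeZerosPrg (List.ofFn w.cell)
      { found := decide (n₀ < n₁), acc := decide (n₀ ≠ n₁) }
      { gate := g, wire := List.replicate ℓ false, tape := List.ofFn w.cell
        out := d.bits.map some } rfl).of
      (by
        have : ((List.ofFn w.cell).countP fun a => decide (n₀ ≠ n₁) && !a.b) = z := by
          by_cases h : n₀ = n₁
          · simp [hz, h]
          · simpa [hz, h] using countP_ofFn_cell w
        rw [this]) (by simp)
  have h₆ := runs_writeRootsPrg g { found := decide (n₀ < n₁), acc := decide (n₀ ≠ n₁) }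
      { gate := g, wire := List.replicate ℓ false
        out := some (decide (n₀ < n₁)) :: (List.replicate z (some false) ++ d.bits.map some) } rfl
  have h₇ := runs_drainWire (List.replicate ℓ false)
      { found := decide (n₀ < n₁), acc := decide (n₀ ≠ n₁) }
      { wire := List.replicate ℓ false
        out := List.replicate (countTagH g) none ++
          some (decide (n₀ < n₁)) :: (List.replicate z (some false) ++ d.bits.map some) } rfl
  rw [encodeAmplitude_two_pow_mul]
  refine (h₁.seq (h₂.seq (h₃.seq (h₄.seq (h₅.seq ((Runs.straight rfl rfl).seq
    (h₆.seq (h₇.seq (Runs.straight rfl rfl))))))))).mono ?_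
  rw [List.length_replicate]
  omega

/-! ### The complete machine -/

/-- The program that computes amplitudes. -/
def amplitudePrg : Prg := readPrg ;; greedyPrg ;; countPrg ;; writePrg

/-- The machine that computes amplitudes. -/
noncomputable def amplitudeMachine : Turing.TM2ComputableAux CircuitSymbol (Option Bool) where
  tm :=
    { K := StackName
      k₀ := .inp
      k₁ := .out
      Γ := StackAlphabet
      Λ := Option amplitudePrg.Loc
      main := none
      ΛFin := letI := amplitudePrg.locFintype; inferInstance
      σ := Reg
      initialState := {}
      Γk₀Fin := inferInstanceAs (Fintype CircuitSymbol)
      m := fun l => match l with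
        | none => amplitudePrg.code some .halt
        | some l => amplitudePrg.table some .halt l }
  inputAlphabet := Equiv.refl _
  outputAlphabet := Equiv.refl _

/-- The extra step is the entry at the main label `none`. -/
theorem outputsInTime_of_runs {l : List CircuitSymbol} {o : List (Option Bool)} {t : ℕ}
    (h : Runs amplitudePrg ⟨{}, { inp := l }⟩ ⟨{}, { out := o }⟩ t) :
    Nonempty (Turing.TM2OutputsInTime amplitudeMachine.tm
      (l.map amplitudeMachine.inputAlphabet.symm)
      (some (o.map amplitudeMachine.outputAlphabet.symm)) (t + 1)) := by
  obtain ⟨u, hu, e⟩ := h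
  refine ⟨⟨⟨u + 1, ?_⟩, Nat.succ_le_succ hu⟩⟩
  have h₁ : Turing.initList amplitudeMachine.tm (l.map amplitudeMachine.inputAlphabet.symm) =
      ⟨some none, {}, Mem.get { inp := l }⟩ := by
    refine congrArg (Turing.TM2.Cfg.mk (some none) ({} : Reg)) (funext fun k => ?_)
    cases k <;> first | rfl | exact List.map_id l
  have h₂ : Turing.haltList amplitudeMachine.tm (o.map amplitudeMachine.outputAlphabet.symm) =
      ⟨none, {}, Mem.get { out := o }⟩ := by
    refine congrArg (Turing.TM2.Cfg.mk none ({} : Reg)) (funext fun k => ?_)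
    cases k <;> first | rfl | exact List.map_id o
  rw [h₁, Option.map_some, h₂, Function.iterate_succ_apply]
  exact e.iterate_step (m := amplitudeMachine.tm.m) some .halt fun _ => rfl

end

/-! ### Degree by iterated derivatives -/

/-- A function on a vector space over the field with two elements has degree less than `d` if all
its `d`-fold derivatives vanish. -/
def DegLT {V : Type} [AddCommGroup V] : ℕ → (V → Bool) → Prop
  | 0, f => ∀ x, f x = 0
  | d + 1, f => ∀ u, DegLT d fun x => f (x + u) + f x

namespace DegLT

variable {V V' : Type} [AddCommGroup V] [AddCommGroup V'] {d : ℕ} {f g : V → Bool}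

theorem add (hf : DegLT d f) (hg : DegLT d g) : DegLT d fun x => f x + g x := by
  induction d generalizing f g with
  | zero => intro x; simp [hf x, hg x]
  | succ d ih =>
    intro u
    refine (congrArg (DegLT d) (funext fun x => ?_)).mp (ih (hf u) (hg u))
    ring

theorem succ (hf : DegLT d f) : DegLT (d + 1) f := by
  induction d generalizing f with
  | zero => intro u x; simp [hf _]
  | succ d ih => intro u; exact ih (hf u)

theorem comp (hf : DegLT d f) (φ : V' →+ V) : DegLT d fun x => f (φ x) := by
  induction d generalizing f with
  | zero => intro x; exact hf _
  | succ d ih =>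
    intro u
    simpa only [map_add] using ih (hf (φ u))

theorem translate (hf : DegLT d f) (u : V) : DegLT d fun x => f (x + u) := by
  induction d generalizing f with
  | zero => intro x; exact hf _
  | succ d ih =>
    intro v
    refine (congrArg (DegLT d) (funext fun x => ?_)).mp (ih (hf v))
    rw [add_right_comm]

theorem zero : ∀ d, DegLT d fun _ : V => false
  | 0 => fun _ => rfl
  | d + 1 => fun _ => zero d

/-- The Leibniz rule $D_u(\varphi f)(x)=\varphi(x)\,D_uf(x)+\varphi(u)\,f(x+u)$: the first summand
is handled by induction, and the second is a constant times a translate of $f$. -/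
theorem linear_mul (φ : V →+ Bool) (hf : DegLT d f) : DegLT (d + 1) fun x => φ x * f x := by
  induction d generalizing f with
  | zero => intro u x; simp [hf _]
  | succ d ih =>
    intro u
    have h₂ : DegLT (d + 1) fun x => φ u * f (x + u) := by
      cases φ u
      · exact zero (d + 1)
      · exact hf.translate u
    refine (congrArg (DegLT (d + 1)) (funext fun x => ?_)).mp ((ih (hf u)).add h₂)
    change φ x * (f (x + u) + f x) + φ u * f (x + u) = φ (x + u) * f (x + u) + φ x * f x
    rw [map_add]
    generalize φ x = a, φ u = b, f (x + u) = c, f x = e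
    revert a b c e
    decide

end DegLT

/-! ### Testing for periods at vectors of weight at most two -/

section

variable {n : ℕ}

theorem bool_add_eq_zero {a b : Bool} : a + b = 0 ↔ a = b := by
  revert a b
  decide

theorem boolVec_add_self (x : Fin n → Bool) : x + x = 0 := funext fun _ => Bool.xor_self _

theorem eq_zero_of_add_pointerVec {g : (Fin n → Bool) → Bool}
    (h : ∀ x, ∀ j < n, g (x + pointerVec n (j + 1)) = g x) (x : Fin n → Bool) : g x = g 0 := by
  -- The coordinates of `x` are switched on one by one, starting from zero.
  have key : ∀ k ≤ n, g (fun j => x j && decide (j.1 < k)) = g 0 := by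
    intro k
    induction k with
    | zero =>
      intro _
      congr 1
      funext j
      simp
      rfl
    | succ k ih =>
      intro hk
      rw [← ih (by omega)]
      cases hx : x ⟨k, hk⟩
      · congr 1
        funext j
        by_cases hj : j = ⟨k, hk⟩
        · simp [hj, hx]
        · have : (j.1 < k + 1) ↔ j.1 < k := by
            have : j.1 ≠ k := fun e => hj (Fin.ext e)
            omega
          simp only [this]
      · rw [← h _ k hk]
        congr 1
        funext j
        change xor _ (pointerVec n (k + 1) j) = _
        rw [pointerVec]
        by_cases hj : j = ⟨k, hk⟩
        · simp [hj, hx]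
        · have hj : j.1 ≠ k := fun e => hj (Fin.ext e)
          have : (j.1 < k + 1) ↔ j.1 < k := by omega
          have h' : decide (k + 1 = j.1 + 1) = false := by simp; omega
          simp only [this, h', Bool.xor_false]
  rw [← key n le_rfl]
  congr 1
  funext j
  simp

/-- The second derivative along two unit vectors is constant, as third derivatives vanish, and its
value at 0 is a sum of four values of `g` at vectors of weight at most two, hence 0. So first
derivatives along unit vectors are constant, and they too vanish at 0. So `g` is constant, with
value `g 0 = 0`. -/
theorem DegLT.eq_zero_of_quad {g : (Fin n → Bool) → Bool} (hg : DegLT 3 g)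
    (h : ∀ p < n + 1, ∀ q < n + 1, g (pointerVec n p + pointerVec n q) = 0) (x : Fin n → Bool) :
    g x = 0 := by
  have h0 : pointerVec n 0 = 0 := pointerVec_eq_zero (Or.inr rfl)
  have hz : g 0 = 0 := by simpa [h0] using h 0 (by omega) 0 (by omega)
  have h1 : ∀ p < n, g (pointerVec n (p + 1)) = 0 := fun p hp => by
    simpa [h0] using h (p + 1) (by omega) 0 (by omega)
  have h2 : ∀ p < n, ∀ x, g (x + pointerVec n (p + 1)) + g x = 0 := by
    intro p hp x
    have := eq_zero_of_add_pointerVec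
      (g := fun x => g (x + pointerVec n (p + 1)) + g x) (fun x q hq => ?_) x
    · simpa only [zero_add, h1 p hp, hz] using this
    have h3 := hg (pointerVec n (p + 1)) (pointerVec n (q + 1))
    have h4 := eq_zero_of_add_pointerVec (g := fun x =>
      g (x + pointerVec n (q + 1) + pointerVec n (p + 1)) + g (x + pointerVec n (q + 1)) +
        (g (x + pointerVec n (p + 1)) + g x))
      (fun x r _ => bool_add_eq_zero.mp (h3 (pointerVec n (r + 1)) x)) x
    have h5 := h (q + 1) (by omega) (p + 1) (by omega)
    simp only [zero_add, h5, h1 p hp, h1 q hq, hz] at h4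
    exact bool_add_eq_zero.mp h4
  rw [eq_zero_of_add_pointerVec (fun x p hp => bool_add_eq_zero.mp (h2 p hp x)) x, hz]

theorem boolVec_neg (x : Fin n → Bool) : -x = x := rfl

/-- The derivative of a function of degree at most three has degree at most two, so the preceding
criterion applies to it. -/
theorem quadTest_iff {f : (Fin n → Bool) → Bool} (hf : DegLT 4 f) (w : Fin n → Bool) :
    quadTest f w = true ↔ ∀ y, f (y + w) = f y := by
  rw [quadTest, decide_eq_true_eq]
  refine ⟨fun h y => bool_add_eq_zero.mp ?_, fun h p _ q _ => by rw [add_comm w, h]⟩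
  refine DegLT.eq_zero_of_quad (hf w) (fun p hp q hq => bool_add_eq_zero.mpr ?_) y
  rw [add_comm _ w, h p hp q hq]

/-! ### Greedy selection of a complement of the periods -/

/-- Vectors that do not change the function when they are added to the argument. -/
def IsPeriod (f : (Fin n → Bool) → Bool) (w : Fin n → Bool) : Prop := ∀ y, f (y + w) = f y

theorem IsPeriod.add {f : (Fin n → Bool) → Bool} {w w' : Fin n → Bool} (h : IsPeriod f w)
    (h' : IsPeriod f w') : IsPeriod f (w + w') := fun y => by rw [← add_assoc, h', h]

/-- Is a vector zero outside of the selected coordinates? -/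
def SuppIn (B x : Fin n → Bool) : Prop := ∀ j, x j = true → B j = true

theorem SuppIn.add {B x y : Fin n → Bool} (hx : SuppIn B x) (hy : SuppIn B y) :
    SuppIn B (x + y) := by
  intro j h
  change xor (x j) (y j) = true at h
  cases hxj : x j
  · cases hyj : y j
    · simp [hxj, hyj] at h
    · exact hy j hyj
  · exact hx j hxj

theorem SuppIn.mono {B B' x : Fin n → Bool} (hx : SuppIn B x)
    (h : ∀ j, B j = true → B' j = true) : SuppIn B' x := fun j hj => h j (hx j hj)

theorem searchTest_iff {f : (Fin n → Bool) → Bool} (hf : DegLT 4 f) (B : Fin n → Bool) (i : ℕ) :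
    searchTest f B i = true ↔ ∃ x, SuppIn B x ∧ IsPeriod f (x + pointerVec n i) := by
  simp only [searchTest, decide_eq_true_eq, quadTest_iff hf]
  constructor
  · rintro ⟨t, _, h⟩
    exact ⟨_, le_of_counterBits B t, h⟩
  · rintro ⟨x, hx, h⟩
    obtain ⟨t, ht, rfl⟩ := exists_counterBits B x hx
    exact ⟨t, ht, h⟩

theorem greedy_mono (f : (Fin n → Bool) → Bool) (k : ℕ) (j : Fin n) (h : greedy f k j = true) :
    greedy f (k + 1) j = true := by
  rw [greedy]
  split
  · exact h
  · simp [h]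

/-- A nonzero period on the enlarged selection that uses the new coordinate would, after removal of
that coordinate, be a vector which makes the search succeed; but then the coordinate would not have
been added. -/
theorem greedy_independent {f : (Fin n → Bool) → Bool} (hf : DegLT 4 f) (k : ℕ) :
    ∀ x, SuppIn (greedy f k) x → IsPeriod f x → x = 0 := by
  induction k with
  | zero =>
    intro x hx _
    funext j
    cases h : x j
    · rfl
    · exact absurd (hx j h) (by simp [greedy])
  | succ k ih =>
    intro x hx hp
    by_cases hs : searchTest f (greedy f k) (k + 1) = true
    · rw [greedy, if_pos hs] at hx
      exact ih x hx hp
    · rw [greedy, if_neg hs] at hx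
      rw [searchTest_iff hf] at hs
      by_cases hk : ∃ j : Fin n, j.1 = k ∧ x j = true
      · refine absurd ⟨x + pointerVec n (k + 1), fun j hj => ?_, ?_⟩ hs
        · obtain ⟨i, rfl, hi⟩ := hk
          change xor (x j) (pointerVec n (i + 1) j) = true at hj
          have := hx j
          by_cases hij : i = j
          · simp [← hij, hi, pointerVec] at hj
          · have : i.1 ≠ j.1 := fun e => hij (Fin.ext e)
            simp_all [pointerVec]
        · rwa [add_assoc, boolVec_add_self, add_zero]
      · refine ih x (fun j hj => ?_) hp
        have : j.1 ≠ k := fun e => hk ⟨j, e, hj⟩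
        have h' := hx j hj
        simpa [pointerVec, this.symm] using h'

/-- A unit vector is either selected or, by the successful search, congruent modulo periods to a
vector on the earlier selection. Additivity extends this to all vectors on the first `k`
coordinates. -/
theorem greedy_spanning {f : (Fin n → Bool) → Bool} (hf : DegLT 4 f) (k : ℕ) :
    ∀ y : Fin n → Bool, (∀ j, y j = true → j.1 < k) →
      ∃ x, SuppIn (greedy f k) x ∧ IsPeriod f (y + x) := by
  induction k with
  | zero =>
    intro y hy
    refine ⟨0, (fun j hj => by cases hj), ?_⟩
    have : y = 0 := by
      funext j
      cases h : y j
      · rfl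
      · exact absurd (hy j h) (by omega)
    intro z
    simp [this]
  | succ k ih =>
    intro y hy
    by_cases hk : ∃ j : Fin n, j.1 = k ∧ y j = true
    · obtain ⟨x, hx, hp⟩ := ih (y + pointerVec n (k + 1)) fun j hj => by
        obtain ⟨i, rfl, hi⟩ := hk
        change xor (y j) (pointerVec n (i + 1) j) = true at hj
        by_cases hij : i = j
        · simp [← hij, hi, pointerVec] at hj
        · have h₁ : i.1 ≠ j.1 := fun e => hij (Fin.ext e)
          have h₂ : y j = true := by simpa [pointerVec, h₁] using hj
          have := hy j h₂
          omega
      by_cases hs : searchTest f (greedy f k) (k + 1) = true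
      · obtain ⟨x', hx', hp'⟩ := (searchTest_iff hf _ _).mp hs
        refine ⟨x + x', (hx.add hx').mono (greedy_mono f k), ?_⟩
        convert hp.add hp' using 1
        rw [show y + pointerVec n (k + 1) + x + (x' + pointerVec n (k + 1)) =
          y + (x + x') + (pointerVec n (k + 1) + pointerVec n (k + 1)) by abel,
          boolVec_add_self, add_zero]
      · refine ⟨x + pointerVec n (k + 1), (hx.mono (greedy_mono f k)).add fun j hj => ?_, ?_⟩
        · rw [greedy, if_neg hs]
          simp [hj]
        · rwa [add_comm x, ← add_assoc]
    · obtain ⟨x, hx, hp⟩ := ih y fun j hj => by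
        have : j.1 ≠ k := fun e => hk ⟨j, e, hj⟩
        have := hy j hj
        omega
      exact ⟨x, hx.mono (greedy_mono f k), hp⟩

-- The vectors supported on the final selection represent each coset of the periods exactly once,
-- and all cosets have as many elements as there are periods.
open Classical in
theorem sum_eq_card_mul_sum {f : (Fin n → Bool) → Bool} (hf : DegLT 4 f)
    (F : (Fin n → Bool) → ℤ) (hF : ∀ x y, IsPeriod f (x + y) → F x = F y) :
    ∑ y, F y = (Finset.univ.filter (IsPeriod f)).card *
      ∑ t ∈ Finset.range (2 ^ numSelected (greedy f n)), F (counterBits (greedy f n) t) := by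
  -- Exactly one summand is nonzero, namely the representative of the coset of `y`.
  have h₁ : ∀ y, F y = ∑ t ∈ Finset.range (2 ^ numSelected (greedy f n)),
      if IsPeriod f (y + counterBits (greedy f n) t) then F (counterBits (greedy f n) t)
      else 0 := by
    intro y
    obtain ⟨x, hx, hp⟩ := greedy_spanning hf n y fun j _ => j.2
    obtain ⟨t, ht, rfl⟩ := exists_counterBits _ x hx
    rw [Finset.sum_eq_single t, if_pos hp, hF _ _ hp]
    · intro t' ht' hne
      refine if_neg fun hp' => hne ?_
      refine counterBits_injOn _ (Finset.mem_range.mp ht') ht ?_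
      have h := greedy_independent hf n (counterBits (greedy f n) t' + counterBits (greedy f n) t)
        (SuppIn.add (le_of_counterBits _ _) (le_of_counterBits _ _)) (by
          have := hp.add hp'
          rwa [show y + counterBits (greedy f n) t + (y + counterBits (greedy f n) t') =
            (y + y) + (counterBits (greedy f n) t' + counterBits (greedy f n) t) by abel,
            boolVec_add_self, zero_add] at this)
      exact (eq_neg_of_add_eq_zero_left h).trans (boolVec_neg _)
    · intro h
      exact absurd (Finset.mem_range.mpr ht) h
  rw [Finset.sum_congr rfl fun y _ => h₁ y, Finset.sum_comm, Finset.mul_sum]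
  refine Finset.sum_congr rfl fun t _ => ?_
  rw [← Finset.sum_filter, Finset.sum_const, nsmul_eq_mul]
  congr 2
  refine Finset.card_bij (fun y _ => y + counterBits (greedy f n) t) ?_ ?_ ?_
  · intro y hy
    simpa using hy
  · intro y _ y' _ h
    exact add_right_cancel h
  · intro w hw
    refine ⟨w + counterBits (greedy f n) t, ?_, ?_⟩
    · simpa [add_assoc, boolVec_add_self] using hw
    · rw [add_assoc, boolVec_add_self, add_zero]

/-- The sign of a phase. -/
def phaseSign (b : Bool) : ℤ := if b then -1 else 1

theorem sum_phaseSign_counterBits (f : (Fin n → Bool) → Bool) (B : Fin n → Bool) (k : ℕ) :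
    ∑ t ∈ Finset.range k, phaseSign (f (counterBits B t)) =
      (countValue f B false k : ℤ) - countValue f B true k := by
  induction k with
  | zero => simp [countValue]
  | succ k ih =>
    rw [Finset.sum_range_succ, ih, countValue_succ, countValue_succ]
    cases f (counterBits B k) <;> simp [phaseSign] <;> ring

theorem sum_phaseSign {f : (Fin n → Bool) → Bool} (hf : DegLT 4 f) :
    ∑ y, phaseSign (f y) = 2 ^ (n - numSelected (greedy f n)) *
      ((countValue f (greedy f n) false (2 ^ numSelected (greedy f n)) : ℤ) -
        countValue f (greedy f n) true (2 ^ numSelected (greedy f n))) := by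
  classical
  have h₁ := sum_eq_card_mul_sum hf (fun y => phaseSign (f y)) (fun x y h => by
    have := h x
    rw [← add_assoc, boolVec_add_self, zero_add] at this
    rw [this])
  -- The constant function 1 shows that the number of periods times `2 ^ numSelected` is `2 ^ n`.
  have h₂ := sum_eq_card_mul_sum hf (fun _ => 1) (fun _ _ _ => rfl)
  rw [h₁, ← sum_phaseSign_counterBits]
  congr 1
  have hle := numSelected_le (greedy f n)
  simp only [Finset.sum_const, Finset.card_univ, Fintype.card_fun, Fintype.card_bool,
    Fintype.card_fin, Finset.card_range, nsmul_eq_mul, mul_one] at h₂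
  push_cast at h₂
  refine mul_right_cancel₀ (b := (2 : ℤ) ^ numSelected (greedy f n)) (by positivity) ?_
  rw [← h₂, ← pow_add, Nat.sub_add_cancel hle]

theorem countValue_add (f : (Fin n → Bool) → Bool) (B : Fin n → Bool) (k : ℕ) :
    countValue f B false k + countValue f B true k = k := by
  induction k with
  | zero => simp [countValue]
  | succ k ih =>
    rw [countValue_succ, countValue_succ]
    cases f (counterBits B k) <;> simp <;> omega

/-- Vectors on the selection with equal image under `π` differ by a period supported there, which is
zero. So `π` is injective on these vectors, and they number at most `2 ^ v`. -/
theorem numSelected_greedy_le {f : (Fin n → Bool) → Bool} (hf : DegLT 4 f) (k : ℕ)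
    {α : Type} [Fintype α] {v : ℕ} (hα : Fintype.card α = 2 ^ v) (π : (Fin n → Bool) → α)
    (hπ : ∀ x y, π x = π y → IsPeriod f (x + y)) : numSelected (greedy f k) ≤ v := by
  refine (Nat.pow_le_pow_iff_right one_lt_two).mp ?_
  rw [← hα, ← Finset.card_range (2 ^ numSelected (greedy f k)), ← Finset.card_univ]
  refine Finset.card_le_card_of_injOn (fun t => π (counterBits (greedy f k) t))
    (fun _ _ => Finset.mem_coe.mpr (Finset.mem_univ _)) fun t ht t' ht' h => ?_
  refine counterBits_injOn _ (Finset.mem_range.mp ht) (Finset.mem_range.mp ht') ?_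
  have := greedy_independent hf k _ (SuppIn.add (le_of_counterBits _ _) (le_of_counterBits _ _))
    (hπ _ _ h)
  exact (eq_neg_of_add_eq_zero_left this).trans (boolVec_neg _)

end

/-! ### Wires and remaining variables along a path -/

/-- The values of the wires after a list of gates. -/
def wiresAfter {ℓ : ℕ} : List (QGate ℓ) → (Fin ℓ → Bool) → (ℕ → Bool) → Fin ℓ → Bool
  | [], c, _ => c
  | g :: gs, c, y => wiresAfter gs (g.wires c y) (g.rest y)

/-- The variables that are left after a list of gates. -/
def restAfter {ℓ : ℕ} : List (QGate ℓ) → (ℕ → Bool) → ℕ → Bool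
  | [], y => y
  | g :: gs, y => restAfter gs (g.rest y)

/-- The number of Hadamard gates in a list of gates. -/
def numHadamard {ℓ : ℕ} : List (QGate ℓ) → ℕ
  | [] => 0
  | .H _ :: gs => numHadamard gs + 1
  | _ :: gs => numHadamard gs

section

variable {ℓ : ℕ}

theorem wiresAfter_append (gs gs' : List (QGate ℓ)) (c : Fin ℓ → Bool) (y : ℕ → Bool) :
    wiresAfter (gs ++ gs') c y = wiresAfter gs' (wiresAfter gs c y) (restAfter gs y) := by
  induction gs generalizing c y with
  | nil => rfl
  | cons g gs ih => exact ih _ _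

theorem pathPhase_append (gs gs' : List (QGate ℓ)) (c : Fin ℓ → Bool) (y : ℕ → Bool) :
    pathPhase (gs ++ gs') c y =
      xor (pathPhase gs c y) (pathPhase gs' (wiresAfter gs c y) (restAfter gs y)) := by
  induction gs generalizing c y with
  | nil => exact (Bool.false_xor _).symm
  | cons g gs ih =>
    change xor _ (pathPhase (gs ++ gs') _ _) = _
    rw [ih, ← Bool.xor_assoc]
    rfl

theorem numHadamard_append (gs gs' : List (QGate ℓ)) :
    numHadamard (gs ++ gs') = numHadamard gs + numHadamard gs' := by
  induction gs with
  | nil => exact (Nat.zero_add _).symm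
  | cons g gs ih => cases g <;> simp only [List.cons_append, numHadamard, ih]; omega

theorem numHadamard_map_H (L : List (Fin ℓ)) : numHadamard (L.map QGate.H) = L.length := by
  induction L with
  | nil => rfl
  | cons i L ih => exact congrArg (· + 1) ih

theorem restAfter_apply (gs : List (QGate ℓ)) (y : ℕ → Bool) (j : ℕ) :
    restAfter gs y j = y (j + numHadamard gs) := by
  induction gs generalizing y with
  | nil => rfl
  | cons g gs ih =>
    rw [restAfter, ih]
    cases g <;> simp only [numHadamard, QGate.rest, add_assoc]

theorem countTagH_encodeUnary (k : ℕ) : countTagH (encodeUnary k) = 0 := by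
  simp [countTagH, encodeUnary, CircuitSymbol.isTagH]

theorem countTagH_flatMap_encode (gs : List (QGate ℓ)) :
    countTagH (gs.flatMap QGate.encode) = numHadamard gs := by
  induction gs with
  | nil => rfl
  | cons g gs ih =>
    have h := countTagH_encodeUnary
    simp only [countTagH] at h ih ⊢
    rw [List.flatMap_cons, List.countP_append, ih]
    cases g <;> simp [QGate.encode, List.countP_cons, h, CircuitSymbol.isTagH, numHadamard, add_comm]

/-- For the last column: Hadamard gates whose new variables are all zero contribute no sign. -/
theorem pathPhase_map_H_zero (L : List (Fin ℓ)) (c : Fin ℓ → Bool) :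
    pathPhase (L.map QGate.H) c (fun _ => false) = false := by
  induction L generalizing c with
  | nil => rfl
  | cons i L ih =>
    rw [List.map_cons, pathPhase]
    simp only [QGate.phase, Bool.and_false, Bool.false_xor]
    exact ih _

/-- For the first column: without repetitions, each wire is still zero when its Hadamard gate is
reached. -/
theorem pathPhase_map_H {L : List (Fin ℓ)} (hL : L.Nodup) {c : Fin ℓ → Bool}
    (hc : ∀ i ∈ L, c i = false) (y : ℕ → Bool) : pathPhase (L.map QGate.H) c y = false := by
  induction L generalizing c y with
  | nil => rfl
  | cons i L ih =>
    rw [List.nodup_cons] at hL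
    rw [List.map_cons, pathPhase]
    simp only [QGate.phase, hc i List.mem_cons_self, Bool.false_and, Bool.false_xor]
    refine ih hL.2 (fun j hj => ?_) _
    have : j ≠ i := fun e => hL.1 (e ▸ hj)
    simpa [QGate.wires, this] using hc j (List.mem_cons_of_mem _ hj)

theorem bitSeq_add {n : ℕ} (x y : Fin n → Bool) :
    bitSeq (List.ofFn (x + y)) = bitSeq (List.ofFn x) + bitSeq (List.ofFn y) := by
  funext j
  rw [Pi.add_apply]
  simp only [bitSeq, List.getD_eq_getElem?_getD, List.getElem?_ofFn]
  split <;> rfl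

theorem bitSeq_ofFn_of_le {n : ℕ} (y : Fin n → Bool) {j : ℕ} (hj : n ≤ j) :
    bitSeq (List.ofFn y) j = false := by
  simp [bitSeq, hj]

end

namespace QGate

variable {ℓ : ℕ}

theorem wires_add (g : QGate ℓ) (c c' : Fin ℓ → Bool) (y y' : ℕ → Bool) :
    g.wires (c + c') (y + y') = g.wires c y + g.wires c' y' := by
  cases g
  case H i =>
    funext j
    rw [Pi.add_apply]
    simp only [wires, Function.update_apply]
    split <;> rfl
  all_goals rfl

theorem rest_add (g : QGate ℓ) (y y' : ℕ → Bool) : g.rest (y + y') = g.rest y + g.rest y' := by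
  cases g <;> rfl

/-- The values of the wires and the variables that are left after a gate, as a linear function. -/
def step (g : QGate ℓ) : (Fin ℓ → Bool) × (ℕ → Bool) →+ (Fin ℓ → Bool) × (ℕ → Bool) where
  toFun z := (g.wires z.1 z.2, g.rest z.2)
  map_zero' := by
    refine Prod.ext ?_ (by cases g <;> rfl)
    cases g
    case H i => exact Function.update_eq_self i 0
    all_goals rfl
  map_add' z z' := Prod.ext (g.wires_add _ _ _ _) (g.rest_add _ _)

theorem degLT_phase (g : QGate ℓ) :
    DegLT 4 fun z : (Fin ℓ → Bool) × (ℕ → Bool) => g.phase z.1 z.2 := by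
  let w (i : Fin ℓ) : (Fin ℓ → Bool) × (ℕ → Bool) →+ Bool :=
    (Pi.evalAddMonoidHom _ i).comp (AddMonoidHom.fst _ _)
  let v : (Fin ℓ → Bool) × (ℕ → Bool) →+ Bool :=
    (Pi.evalAddMonoidHom _ 0).comp (AddMonoidHom.snd _ _)
  have h₁ : DegLT 1 fun _ : (Fin ℓ → Bool) × (ℕ → Bool) => true := fun _ _ => rfl
  have h₂ (i : Fin ℓ) : DegLT 2 fun z : (Fin ℓ → Bool) × (ℕ → Bool) => z.1 i :=
    (congrArg (DegLT 2) (funext fun z => Bool.and_true _)).mp (h₁.linear_mul (w i))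
  have h₃ : DegLT 2 fun z : (Fin ℓ → Bool) × (ℕ → Bool) => z.2 0 :=
    (congrArg (DegLT 2) (funext fun z => Bool.and_true _)).mp (h₁.linear_mul v)
  cases g with
  | H i => exact (h₃.linear_mul (w i)).succ
  | Z i => exact (h₂ i).succ.succ
  | CZ i j _ => exact ((h₂ j).linear_mul (w i)).succ
  | CCZ i j k _ _ _ =>
    exact (congrArg (DegLT 4) (funext fun z => (Bool.and_assoc _ _ _).symm)).mp
      (((h₂ k).linear_mul (w j)).linear_mul (w i))

end QGate

section

variable {ℓ : ℕ}

/-- Passing a gate acts linearly on wires and remaining variables, so the phases of later gates keep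
degree at most three as functions of the starting data. -/
theorem degLT_pathPhase (gs : List (QGate ℓ)) :
    DegLT 4 fun z : (Fin ℓ → Bool) × (ℕ → Bool) => pathPhase gs z.1 z.2 := by
  induction gs with
  | nil => exact DegLT.zero 4
  | cons g gs ih => exact g.degLT_phase.add (ih.comp g.step)

theorem degLT_pathFun {n : ℕ} (gs : List (QGate ℓ)) :
    DegLT 4 (pathFun gs : (Fin n → Bool) → Bool) := by
  let φ : (Fin n → Bool) →+ (Fin ℓ → Bool) × (ℕ → Bool) :=
    { toFun := fun y => (0, bitSeq (List.ofFn y))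
      map_zero' := Prod.ext rfl (funext fun j => by
        simp only [bitSeq, List.getD_eq_getElem?_getD, List.getElem?_ofFn]
        split <;> rfl)
      map_add' := fun x y => Prod.ext rfl (bitSeq_add x y) }
  exact (degLT_pathPhase gs).comp φ

theorem wiresAfter_add (gs : List (QGate ℓ)) (c c' : Fin ℓ → Bool) (y y' : ℕ → Bool) :
    wiresAfter gs (c + c') (y + y') = wiresAfter gs c y + wiresAfter gs c' y' := by
  induction gs generalizing c c' y y' with
  | nil => rfl
  | cons g gs ih => rw [wiresAfter, g.wires_add, g.rest_add, ih]; rfl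

theorem restAfter_add (gs : List (QGate ℓ)) (y y' : ℕ → Bool) :
    restAfter gs (y + y') = restAfter gs y + restAfter gs y' := by
  funext j
  rw [Pi.add_apply]
  simp only [restAfter_apply]
  rfl

/-! ### Segments and the polynomial of the circuit -/

/-- The value of segment `j` of wire `i`. -/
def segmentValue : List (QGate ℓ) → (Fin ℓ → Bool) → (ℕ → Bool) → Fin ℓ → ℕ → Bool
  | [], c, _, i, _ => c i
  | g :: gs, c, y, i, j =>
    if g.isHadamardOn i then
      if j = 0 then c i else segmentValue gs (g.wires c y) (g.rest y) i (j - 1)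
    else segmentValue gs (g.wires c y) (g.rest y) i j

theorem QGate.wires_of_not_isHadamardOn {g : QGate ℓ} {i : Fin ℓ} (h : ¬g.isHadamardOn i)
    (c : Fin ℓ → Bool) (y : ℕ → Bool) : g.wires c y i = c i := by
  cases g
  case H j =>
    have : i ≠ j := fun e => h (by simp [QGate.isHadamardOn, e])
    simp [QGate.wires, this]
  all_goals rfl

theorem segmentValue_zero (gs : List (QGate ℓ)) (c : Fin ℓ → Bool) (y : ℕ → Bool) (i : Fin ℓ) :
    segmentValue gs c y i 0 = c i := by
  induction gs generalizing c y with
  | nil => rfl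
  | cons g gs ih =>
    rw [segmentValue]
    split
    · rfl
    · next h => rw [ih, QGate.wires_of_not_isHadamardOn h]

theorem segmentValue_hadamardCount (gs : List (QGate ℓ)) (c : Fin ℓ → Bool) (y : ℕ → Bool)
    (i : Fin ℓ) (t : ℕ) :
    segmentValue gs c y i (hadamardCount (gs.take t) i) = wiresAfter (gs.take t) c y i := by
  induction gs generalizing c y t with
  | nil => simp [segmentValue, wiresAfter]
  | cons g gs ih =>
    cases t with
    | zero => exact segmentValue_zero _ _ _ _
    | succ t =>
      rw [List.take_succ_cons, wiresAfter, ← ih, segmentValue, hadamardCount, List.countP_cons]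
      split
      · simp [hadamardCount]
      · simp [hadamardCount]

theorem segmentValue_add (gs : List (QGate ℓ)) (c c' : Fin ℓ → Bool) (y y' : ℕ → Bool)
    (i : Fin ℓ) (j : ℕ) : segmentValue gs (c + c') (y + y') i j =
      segmentValue gs c y i j + segmentValue gs c' y' i j := by
  induction gs generalizing c c' y y' j with
  | nil => rfl
  | cons g gs ih =>
    simp only [segmentValue, g.wires_add, g.rest_add, ih]
    split
    · split <;> rfl
    · rfl

/-- Bits as elements of the field with two elements. -/
def bitVal (b : Bool) : ZMod 2 := if b then 1 else 0

theorem bitVal_add (a b : Bool) : bitVal (a + b) = bitVal a + bitVal b := by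
  revert a b
  decide

theorem bitVal_xor (a b : Bool) : bitVal (xor a b) = bitVal a + bitVal b := bitVal_add a b

theorem bitVal_and (a b : Bool) : bitVal (a && b) = bitVal a * bitVal b := by
  revert a b
  decide

theorem bitVal_injective : Function.Injective bitVal := by
  intro a b
  revert a b
  decide

theorem sum_phase (gs : List (QGate ℓ)) (c : Fin ℓ → Bool) (y : ℕ → Bool) :
    ∑ t : Fin gs.length, bitVal ((gs.get t).phase (wiresAfter (gs.take t) c y)
      (restAfter (gs.take t) y)) = bitVal (pathPhase gs c y) := by
  induction gs generalizing c y with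
  | nil => rfl
  | cons g gs ih =>
    rw [pathPhase, bitVal_xor, ← ih]
    exact Fin.sum_univ_succ _

theorem wiresAfter_take_succ (gs : List (QGate ℓ)) (c : Fin ℓ → Bool) (y : ℕ → Bool)
    (t : Fin gs.length) : wiresAfter (gs.take (t + 1)) c y =
      (gs.get t).wires (wiresAfter (gs.take t) c y) (restAfter (gs.take t) y) := by
  rw [← List.take_concat_get' gs t t.2, wiresAfter_append]
  rfl

/-- Gate `t` reads the wires at time `t`, which are the current segments; for a Hadamard gate the
new variable is the segment that follows. So each monomial evaluates to the phase of its gate. -/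
theorem QCircuit.polyFun_segmentValue (C : QCircuit ℓ) (c : Fin ℓ → Bool) (y : ℕ → Bool) :
    C.polyFun (fun s => bitVal (segmentValue C.internal c y s.1 s.2)) =
      bitVal (pathPhase C.internal c y) := by
  rw [← sum_phase, polyFun, polynomial, map_sum]
  refine Finset.sum_congr rfl fun t _ => ?_
  have h := wiresAfter_take_succ C.internal c y t
  have hX (t : ℕ) (i : Fin ℓ) : bitVal (segmentValue C.internal c y i
      (hadamardCount (C.internal.take t) i)) = bitVal (wiresAfter (C.internal.take t) c y i) := by
    rw [segmentValue_hadamardCount]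
  generalize C.internal.get t = g at h
  cases g <;>
    simp only [term, map_mul, MvPolynomial.eval_X, segmentAt, hX, QGate.phase, bitVal_and, h,
      QGate.wires, Function.update_self]

end

/-! ### The amplitude as a sum over paths -/

section

variable {ℓ : ℕ}

/-- A basis state, given by bits. -/
def basisState (c : Fin ℓ → Bool) : QBasis ℓ := fun i => if c i then 1 else 0

/-- The matrix of a list of gates, where the first gate is applied first. -/
noncomputable def circuitMatrix (gs : List (QGate ℓ)) : Matrix (QBasis ℓ) (QBasis ℓ) ℂ :=
  gs.foldl (fun U g => g.toMatrix * U) 1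

/-- The amplitude of `|0⟩` after a list of gates was applied to a basis state. -/
noncomputable def zeroAmplitude (gs : List (QGate ℓ)) (c : Fin ℓ → Bool) : ℂ :=
  circuitMatrix gs 0 (basisState c)

theorem foldl_toMatrix (gs : List (QGate ℓ)) (U : Matrix (QBasis ℓ) (QBasis ℓ) ℂ) :
    gs.foldl (fun U g => g.toMatrix * U) U = circuitMatrix gs * U := by
  induction gs generalizing U with
  | nil => exact (Matrix.one_mul U).symm
  | cons g gs ih =>
    rw [List.foldl_cons, circuitMatrix, List.foldl_cons, ih, ih (g.toMatrix * 1), Matrix.mul_one,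
      Matrix.mul_assoc]

theorem zeroAmplitude_nil (c : Fin ℓ → Bool) :
    zeroAmplitude [] c = if ∀ j, c j = false then 1 else 0 := by
  rw [zeroAmplitude, circuitMatrix, List.foldl_nil, Matrix.one_apply]
  refine if_congr ?_ rfl rfl
  rw [funext_iff]
  refine forall_congr' fun j => ?_
  cases h : c j <;> simp [basisState, h]

theorem zeroAmplitude_cons (g : QGate ℓ) (gs : List (QGate ℓ)) (c : Fin ℓ → Bool) :
    zeroAmplitude (g :: gs) c = ∑ x, circuitMatrix gs 0 x *
      g.toMatrix x (basisState c) := by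
  rw [zeroAmplitude, circuitMatrix, List.foldl_cons, foldl_toMatrix, Matrix.mul_one, Matrix.mul_apply]

theorem phaseSign_xor (a b : Bool) : phaseSign (xor a b) = phaseSign a * phaseSign b := by
  revert a b
  decide

theorem zeroAmplitude_cons_diagonal {g : QGate ℓ} {d : QBasis ℓ → ℂ}
    (hg : g.toMatrix = Matrix.diagonal d) (gs : List (QGate ℓ)) (c : Fin ℓ → Bool) :
    zeroAmplitude (g :: gs) c = d (basisState c) * zeroAmplitude gs c := by
  rw [zeroAmplitude_cons, Finset.sum_eq_single (basisState c), hg, Matrix.diagonal_apply_eq,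
    mul_comm]
  · rfl
  · intro x _ hx
    rw [hg, Matrix.diagonal_apply_ne _ hx, mul_zero]
  · intro h
    exact absurd (Finset.mem_univ _) h

theorem zeroAmplitude_cons_H (i : Fin ℓ) (gs : List (QGate ℓ)) (c : Fin ℓ → Bool) :
    zeroAmplitude (.H i :: gs) c = ((Real.sqrt 2 : ℝ) : ℂ)⁻¹ *
      ∑ b : Bool, phaseSign (c i && b) * zeroAmplitude gs (Function.update c i b) := by
  rw [zeroAmplitude_cons, Finset.mul_sum]
  symm
  refine Finset.sum_of_injOn (fun b => basisState (Function.update c i b)) ?_ ?_ ?_ ?_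
  · intro b _ b' _ h
    have := congrFun h i
    revert this
    cases b <;> cases b' <;> simp [basisState]
  · intro b _
    exact Finset.mem_coe.mpr (Finset.mem_univ _)
  · intro x _ hx
    have : ¬∀ j, j ≠ i → x j = basisState c j := by
      intro h
      refine hx ⟨decide (x i = 1), Finset.mem_coe.mpr (Finset.mem_univ _), funext fun j => ?_⟩
      by_cases hj : j = i
      · subst hj
        have : ∀ a : Fin 2, (if decide (a = 1) = true then (1 : Fin 2) else 0) = a := by decide
        simpa [basisState] using this (x j)
      · simp [basisState, hj, h j hj]
    simp only [QGate.toMatrix, Matrix.of_apply, if_neg this, mul_zero]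
  · intro b _
    have : ∀ j, j ≠ i → basisState (Function.update c i b) j = basisState c j := by
      intro j hj
      simp [basisState, hj]
    simp only [QGate.toMatrix, Matrix.of_apply, if_pos this, zeroAmplitude]
    have h : hadamardMatrix (basisState (Function.update c i b) i) (basisState c i) =
        ((Real.sqrt 2 : ℝ) : ℂ)⁻¹ * phaseSign (c i && b) := by
      cases hc : c i <;> cases b <;> simp [hadamardMatrix, basisState, hc, phaseSign]
    rw [h]
    ring

/-- After its only Hadamard gate a wire must carry 0, so just the term without sign survives at each
gate. -/
theorem zeroAmplitude_map_H {L : List (Fin ℓ)} (hL : L.Nodup) (c : Fin ℓ → Bool) :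
    zeroAmplitude (L.map QGate.H) c =
      if ∀ j, j ∉ L → c j = false then ((Real.sqrt 2 : ℝ) : ℂ)⁻¹ ^ L.length else 0 := by
  induction L generalizing c with
  | nil => simpa using zeroAmplitude_nil c
  | cons i L ih =>
    rw [List.nodup_cons] at hL
    rw [List.map_cons, zeroAmplitude_cons_H, Fintype.sum_bool, ih hL.2, ih hL.2, if_neg, mul_zero,
      zero_add, Bool.and_false]
    · have : (∀ j, j ∉ L → Function.update c i false j = false) ↔
          ∀ j, j ∉ i :: L → c j = false := by
        refine forall_congr' fun j => ?_
        by_cases hj : j = i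
        · simp [hj]
        · simp [hj]
      simp only [this, phaseSign, List.length_cons, pow_succ']
      simp
    · intro h
      simpa using h i hL.1

theorem QGate.toMatrix_eq_diagonal (g : QGate ℓ) (hg : ∀ i, g ≠ .H i) :
    ∃ d : QBasis ℓ → ℂ, g.toMatrix = Matrix.diagonal d ∧
      ∀ c y, d (basisState c) = phaseSign (g.phase c y) := by
  cases g with
  | H i => exact absurd rfl (hg i)
  | Z i =>
    refine ⟨_, rfl, fun c y => ?_⟩
    cases h : c i <;> simp [basisState, phase, phaseSign, h]
  | CZ i j _ =>
    refine ⟨_, rfl, fun c y => ?_⟩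
    cases h : c i <;> cases h' : c j <;> simp [basisState, phase, phaseSign, h, h']
  | CCZ i j k _ _ _ =>
    refine ⟨_, rfl, fun c y => ?_⟩
    cases h : c i <;> cases h' : c j <;> cases h'' : c k <;>
      simp [basisState, phase, phaseSign, h, h', h'']

/-- Induction from the first gate: a diagonal gate multiplies by its sign, and a Hadamard gate adds
a variable and a factor $1/\sqrt2$. The final column covers all wires, so it contributes only
normalization, whatever state reaches it. -/
theorem zeroAmplitude_append {L : List (Fin ℓ)} (hL : L.Nodup) (hL' : ∀ i, i ∈ L)
    (gs : List (QGate ℓ)) (c : Fin ℓ → Bool) :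
    zeroAmplitude (gs ++ L.map QGate.H) c =
      ((Real.sqrt 2 : ℝ) : ℂ)⁻¹ ^ (numHadamard gs + L.length) *
        ∑ y : Fin (numHadamard gs) → Bool,
          (phaseSign (pathPhase (gs ++ L.map QGate.H) c (bitSeq (List.ofFn y))) : ℂ) := by
  have hdiag (g : QGate ℓ) (gs : List (QGate ℓ)) (hg : ∀ i, g ≠ .H i)
      (hn : numHadamard (g :: gs) = numHadamard gs)
      (hp : ∀ c y, pathPhase (g :: (gs ++ L.map QGate.H)) c y =
        xor (g.phase c fun _ => false) (pathPhase (gs ++ L.map QGate.H) c y))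
      (ih : ∀ c, zeroAmplitude (gs ++ L.map QGate.H) c =
        ((Real.sqrt 2 : ℝ) : ℂ)⁻¹ ^ (numHadamard gs + L.length) *
          ∑ y : Fin (numHadamard gs) → Bool,
            (phaseSign (pathPhase (gs ++ L.map QGate.H) c (bitSeq (List.ofFn y))) : ℂ))
      (c : Fin ℓ → Bool) : zeroAmplitude (g :: gs ++ L.map QGate.H) c =
        ((Real.sqrt 2 : ℝ) : ℂ)⁻¹ ^ (numHadamard (g :: gs) + L.length) *
          ∑ y : Fin (numHadamard (g :: gs)) → Bool,
            (phaseSign (pathPhase (g :: gs ++ L.map QGate.H) c (bitSeq (List.ofFn y))) : ℂ) := by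
    obtain ⟨d, hd, hd'⟩ := g.toMatrix_eq_diagonal hg
    rw [hn, List.cons_append, zeroAmplitude_cons_diagonal hd, ih, hd' c fun _ => false,
      mul_left_comm, Finset.mul_sum]
    simp only [hp, phaseSign_xor, Int.cast_mul]
  induction gs generalizing c with
  | nil =>
    rw [List.nil_append, zeroAmplitude_map_H hL, if_pos fun j hj => absurd (hL' j) hj]
    have (y : Fin (numHadamard ([] : List (QGate ℓ))) → Bool) :
        bitSeq (List.ofFn y) = fun _ => false :=
      funext fun j => bitSeq_ofFn_of_le y (Nat.zero_le j)
    simp only [this, pathPhase_map_H_zero]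
    simp [numHadamard, phaseSign]
    rfl
  | cons g gs ih =>
    cases g with
    | H i =>
      rw [List.cons_append, zeroAmplitude_cons_H]
      simp only [ih]
      -- The sum over `y` is split into its first entry, the new value of wire `i`, and the
      -- remaining variables.
      refine Eq.trans ?_ (congrArg _
        ((Fin.consEquiv fun _ : Fin (numHadamard gs + 1) => Bool).sum_comp _))
      change _ = _ ^ (numHadamard gs + 1 + L.length) * _
      rw [Fintype.sum_prod_type, add_right_comm, pow_succ', mul_assoc]
      congr 1
      rw [Finset.mul_sum]
      refine Finset.sum_congr rfl fun b _ => ?_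
      rw [mul_left_comm, Finset.mul_sum]
      congr 1
      refine Finset.sum_congr rfl fun y _ => ?_
      rw [← Int.cast_mul, ← phaseSign_xor]
      have h : bitSeq (List.ofFn (Fin.consEquiv (fun _ : Fin (numHadamard gs + 1) => Bool) (b, y))) =
          bitSeq (b :: List.ofFn y) := by
        rw [List.ofFn_succ]
        rfl
      exact congrArg (fun z => ((phaseSign (pathPhase (.H i :: (gs ++ L.map QGate.H)) c z) : ℤ) : ℂ))
        h.symm
    | Z i => exact hdiag _ gs (fun _ => by simp) rfl (fun _ _ => rfl) ih c
    | CZ i j _ => exact hdiag _ gs (fun _ => by simp) rfl (fun _ _ => rfl) ih c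
    | CCZ i j k _ _ _ => exact hdiag _ gs (fun _ => by simp) rfl (fun _ _ => rfl) ih c

end

/-! ### From the polynomial to the number of selected coordinates -/

namespace QCircuit

variable {ℓ : ℕ} (C : QCircuit ℓ)

/-- The number of variables of the circuit. -/
def numVars : ℕ := ℓ + numHadamard C.internal

theorem numHadamard_gates : numHadamard C.gates = C.numVars + ℓ := by
  rw [gates, numHadamard_append, numHadamard_append, numHadamard_map_H, List.length_finRange,
    numVars]

theorem amplitude_eq : C.amplitude =
    ((∑ y : Fin C.numVars → Bool, phaseSign (pathFun C.gates y) : ℤ) : ℂ) /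
      ((Real.sqrt 2 : ℝ) : ℂ) ^ (C.numVars + ℓ) := by
  have h := zeroAmplitude_append (List.nodup_finRange ℓ) List.mem_finRange
    ((List.finRange ℓ).map QGate.H ++ C.internal) (fun _ => false)
  have hn : numHadamard ((List.finRange ℓ).map QGate.H ++ C.internal) = C.numVars := by
    rw [numHadamard_append, numHadamard_map_H, List.length_finRange, numVars]
  rw [hn, List.length_finRange, inv_pow, inv_mul_eq_div] at h
  rw [Int.cast_sum]
  refine Eq.trans ?_ h
  have : basisState (fun _ : Fin ℓ => false) = 0 := funext fun _ => by simp [basisState]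
  rw [zeroAmplitude, this]
  rfl

/-- The values of the variables of the polynomial of a circuit along a path. -/
def segmentVec (y : Fin C.numVars → Bool) (s : C.Segment) : ZMod 2 :=
  bitVal (segmentValue C.internal
    (wiresAfter ((List.finRange ℓ).map QGate.H) 0 (bitSeq (List.ofFn y)))
    (restAfter ((List.finRange ℓ).map QGate.H) (bitSeq (List.ofFn y))) s.1 s.2)

theorem segmentVec_add (x y : Fin C.numVars → Bool) :
    C.segmentVec (x + y) = C.segmentVec x + C.segmentVec y := by
  funext s
  have h := wiresAfter_add ((List.finRange ℓ).map QGate.H) 0 0 (bitSeq (List.ofFn x))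
    (bitSeq (List.ofFn y))
  rw [add_zero] at h
  rw [Pi.add_apply, segmentVec, bitSeq_add, restAfter_add, h, segmentValue_add, bitVal_add]
  rfl

theorem polyFun_segmentVec (y : Fin C.numVars → Bool) :
    C.polyFun (C.segmentVec y) = bitVal (pathFun C.gates y) := by
  refine (C.polyFun_segmentValue _ _).trans (congrArg bitVal ?_)
  -- The first column and the internal gates use up all variables; the last column reads only the
  -- zeros beyond them.
  have h : restAfter ((List.finRange ℓ).map QGate.H ++ C.internal) (bitSeq (List.ofFn y)) =
      fun _ => false := by
    funext j
    rw [restAfter_apply, bitSeq_ofFn_of_le]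
    rw [numHadamard_append, numHadamard_map_H, List.length_finRange, numVars]
    omega
  rw [pathFun, gates, pathPhase_append, h, pathPhase_map_H_zero, Bool.xor_false, pathPhase_append,
    pathPhase_map_H (List.nodup_finRange ℓ) (fun _ _ => rfl), Bool.false_xor]
  rfl

/-- In the coordinates `w` given by the inverse of `L`, the phase depends only on the entries in
`S`. Two paths that agree there differ by a period, so restriction to `S` is a map as required in
`numSelected_greedy_le`. -/
theorem numSelected_greedy_pathFun_le {v : ℕ} (L : GL C.Segment (ZMod 2)) (S : Finset C.Segment)
    (hS : S.card = v) (hL : DependsOn (linTransform C.polyFun L) (S : Set C.Segment)) (k : ℕ) :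
    numSelected (greedy (pathFun C.gates : (Fin C.numVars → Bool) → Bool) k) ≤ v := by
  let w (y : Fin C.numVars → Bool) : C.Segment → ZMod 2 :=
    Matrix.mulVec ((L⁻¹ : GL C.Segment (ZMod 2)) : Matrix C.Segment C.Segment (ZMod 2))
      (C.segmentVec y)
  have hadd (x y) : w (x + y) = w x + w y := by
    simp only [w, segmentVec_add, Matrix.mulVec_add]
  have hw (y) : bitVal (pathFun C.gates y) = linTransform C.polyFun L (w y) := by
    rw [← polyFun_segmentVec, linTransform]
    simp only [w, Matrix.mulVec_mulVec, ← Units.val_mul, mul_inv_cancel, Units.val_one,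
      Matrix.one_mulVec]
  refine numSelected_greedy_le (degLT_pathFun _) k (α := S → ZMod 2) ?_
    (fun y i => w y i) fun x y h z => bitVal_injective ?_
  · rw [Fintype.card_fun, ZMod.card, Fintype.card_coe, hS]
  · rw [hw, hw]
    refine hL fun i hi => ?_
    have h' : w x i = w y i := congrFun h ⟨i, hi⟩
    rw [hadd, hadd, Pi.add_apply, Pi.add_apply, h', CharTwo.add_self_eq_zero, add_zero]

theorem encodeUnary_length (k : ℕ) : (encodeUnary k).length = k + 1 := by
  simp [encodeUnary]

theorem length_flatMap_encode_le (gs : List (QGate ℓ)) :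
    (gs.flatMap QGate.encode).length ≤ gs.length * (3 * ℓ + 4) := by
  induction gs with
  | nil => simp
  | cons g gs ih =>
    rw [List.flatMap_cons, List.length_append, List.length_cons, Nat.add_one_mul, add_comm]
    refine Nat.add_le_add ih ?_
    cases g with
    | H i => simp only [QGate.encode, List.length_cons, encodeUnary_length]; omega
    | Z i => simp only [QGate.encode, List.length_cons, encodeUnary_length]; omega
    | CZ i j _ =>
      simp only [QGate.encode, List.length_cons, List.length_append, encodeUnary_length]; omega
    | CCZ i j k _ _ _ =>
      simp only [QGate.encode, List.length_cons, List.length_append, encodeUnary_length]; omega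

end QCircuit

/-! ### The total running time -/

/-- A bound for the running time of the machine, in terms of the number of qubits, the length of the
description of the gates, and the number of selected assignments. -/
def runtimeBound (ℓ e N : ℕ) : ℕ :=
  let P := 3 * e + e + 2 * ℓ + 5
  let Q := (e + 1) * ((e + 1) * (2 * P + (2 * e + 2) + 1) + (2 * e + 2) + 1)
  (2 * e + 3 * ℓ + 5) + ((e + 1) * ((2 * e + 2) + N * (Q + (2 * e + 2) + 1) + (2 * e + 2) + 1) +
    (N * (P + (2 * e + 2) + 1) + (11 * N + e + e + ℓ + 7))) + 1

theorem runtimeBound_le_mul {ℓ e N : ℕ} (hN : 0 < N) :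
    runtimeBound ℓ e N ≤ N * runtimeBound ℓ e 1 := by
  have h (a : ℕ) : a ≤ N * a := Nat.le_mul_of_pos_left a hN
  simp only [runtimeBound]
  generalize 3 * e + e + 2 * ℓ + 5 = P
  generalize (e + 1) * ((e + 1) * (2 * P + (2 * e + 2) + 1) + (2 * e + 2) + 1) = Q
  -- These are the terms without a factor `N`; all others are already linear in `N`.
  have h₁ := h ((2 * e + 3 * ℓ + 5) + ((e + 1) * ((2 * e + 2) + (2 * e + 2) + 1) +
    (e + e + ℓ + 7)) + 1)
  linarith

theorem exists_polynomial_runtimeBound (p : Polynomial ℕ) :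
    ∃ q : Polynomial ℕ, ∀ ℓ, q.eval ℓ = runtimeBound ℓ (p.eval ℓ) 1 := by
  let X : Polynomial ℕ := Polynomial.X
  let P := 3 * p + p + 2 * X + 5
  let Q := (p + 1) * ((p + 1) * (2 * P + (2 * p + 2) + 1) + (2 * p + 2) + 1)
  refine ⟨(2 * p + 3 * X + 5) + ((p + 1) * ((2 * p + 2) + 1 * (Q + (2 * p + 2) + 1) +
    (2 * p + 2) + 1) + (1 * (P + (2 * p + 2) + 1) + (11 * 1 + p + p + X + 7))) + 1, fun ℓ => ?_⟩
  simp [runtimeBound, X, P, Q]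

/-- The length `e` also bounds the number of variables, because each of them comes from a Hadamard
tag in the description. -/
theorem QCircuit.outputsInTime {ℓ : ℕ} (C : QCircuit ℓ) {v e : ℕ}
    (he : (C.gates.flatMap QGate.encode).length ≤ e)
    (hv : ∀ k, numSelected (greedy (pathFun C.gates : (Fin C.numVars → Bool) → Bool) k) ≤ v) :
    ComputesAmplitudeInTime amplitudeMachine C (runtimeBound ℓ e (2 ^ v)) := by
  have hk : countTagH (C.gates.flatMap QGate.encode) = C.numVars + ℓ := by
    rw [countTagH_flatMap_encode, numHadamard_gates]
  have hn : C.numVars ≤ e := by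
    have : countTagH (C.gates.flatMap QGate.encode) ≤ _ := List.countP_le_length
    omega
  have h₁ := runs_readPrg (n := C.numVars) C.gates (by rw [hk, Nat.add_sub_cancel])
  have h₂ := runs_greedyPrg (n := C.numVars) (gs := C.gates) fun k _ => hv k
  have hd := hv C.numVars
  have hs := sum_phaseSign (degLT_pathFun (n := C.numVars) C.gates)
  generalize greedy (pathFun C.gates) C.numVars = B at h₂ hd hs
  have h₃ := runs_countPrg (gs := C.gates) B
  have h₄ := runs_writePrg (gs := C.gates) B
    (countValue (pathFun C.gates) B false (2 ^ numSelected B))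
    (countValue (pathFun C.gates) B true (2 ^ numSelected B))
  rw [← hs, hk, countValue_add] at h₄
  refine ⟨_, _, C.amplitude_eq,
    (outputsInTime_of_runs (h₁.seq (h₂.seq (h₃.seq h₄)))).map fun r =>
      ⟨r.toEvalsTo, r.steps_le_m.trans ?_⟩⟩
  have hN := Nat.pow_le_pow_right two_pos hd
  rw [quadTestTime, phaseTime]
  simp only [runtimeBound]
  gcongr

/-- Correctness for every circuit is included, since `L = 1` with all segments in `S` always
satisfies the hypotheses. -/
theorem mainTheorem7 :
    ∃ M : Turing.TM2ComputableAux CircuitSymbol (Option Bool),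
      ∀ p : Polynomial ℕ, ∃ q : Polynomial ℕ,
        ∀ (ℓ : ℕ) (C : QCircuit ℓ), C.size ≤ p.eval ℓ →
          ∀ (v : ℕ) (L : GL C.Segment (ZMod 2)) (S : Finset C.Segment),
            S.card = v → DependsOn (linTransform C.polyFun L) (S : Set C.Segment) →
              ComputesAmplitudeInTime M C (2 ^ v * q.eval ℓ) := by
  refine ⟨amplitudeMachine, fun p => ?_⟩
  -- A gate is described by a tag and at most three unary numbers, hence by at most `3 * ℓ + 4`
  -- symbols.
  have hp (ℓ : ℕ) : (p * (3 * Polynomial.X + 4)).eval ℓ = p.eval ℓ * (3 * ℓ + 4) := by simp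
  obtain ⟨q, hq⟩ := exists_polynomial_runtimeBound (p * (3 * Polynomial.X + 4))
  refine ⟨q, fun ℓ C hC v L S hS hL => ?_⟩
  obtain ⟨a, k, h, ⟨r⟩⟩ := C.outputsInTime (v := v) (e := (p * (3 * Polynomial.X + 4)).eval ℓ) (by
    refine (QCircuit.length_flatMap_encode_le C.gates).trans ?_
    rw [hp]
    exact Nat.mul_le_mul_right _ hC) (C.numSelected_greedy_pathFun_le L S hS hL)
  refine ⟨a, k, h, ⟨⟨r.toEvalsTo, r.steps_le_m.trans ?_⟩⟩⟩
  rw [hq]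
  exact runtimeBound_le_mul (Nat.two_pow_pos v)
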